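/- **Conventions.** A *primitive recursive functional* with $k$ unary function arguments $f_1,\dots,f_k$ and $n$ number arguments is given by a scheme built from zero, successor, projections and the functions $f_i$ by composition and primitive recursion; for $k=0$ these are the primitive recursive functions. The two-sorted language has number variables, variables for unary functions, $0$, $s$, $<$, and a symbol for each such scheme. A structure consists of a first-order universe $N$, a set $\mathcal X$ of functions $N\to N$ over which the function variables range, and interpretations of the symbols. A theory *entails* a sentence if the sentence holds in all structures that are models of the theory (equivalently, by completeness, the sentence is provable from the theory). * $\mathsf{PRA}^2$ has the axioms $0\neq s(x)$; $s(x)=s(y)\to x=y$; $\neg\, x<0$; $x<s(y)\leftrightarrow x<y\vee x=y$; the defining equations of all primitive recursive functions and functionals; for every functional $P$, $\forall \bar f\,\forall\bar a\,\exists g\,\forall x\; g(x)=P(\bar f,x,\bar a)$; and induction for quantifier-free formulas with number and function parameters. * $\mathsf{RCA}_0$ is identified with $\mathsf{PRA}^2+\mathsf{QF}\text{-}\mathsf{AC}$, where $\mathsf{QF}\text{-}\mathsf{AC}$ is the schema $\forall n\,\exists m\,\theta(n,m)\to\exists f\,\forall n\,\theta(n,f(n))$ for quantifier-free $\theta$ with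 number and function parameters. * Fix a primitive recursive coding of finite strings and of pairs by numbers. A function $V$ codes the sequence of open sets $V_n=\bigcup_k\{h : h \text{ extends the string } V(\langle n,k\rangle)\}$ of $\mathbb N^{\mathbb N}$. $V_n$ is *dense* if for every string $\sigma$ there are a string $\tau$ extending $\sigma$ and a $k$ such that $\tau$ extends $V(\langle n,k\rangle)$. $\mathsf{BCT}$ is the sentence: for every $V$ such that all $V_n$ are dense there is a function $h$ with $h\in V_n$ for all $n$. * An *$\omega$-model* is given by a set $\mathcal K$ of functions $\omega\to\omega$ as the range of the function variables, with standard first-order part and the standard interpretation of all symbols. **Theorem.** 1. $\mathsf{PRA}^2+\mathsf{BCT}$ lies strictly between $\mathsf{PRA}^2$ and $\mathsf{RCA}_0$: every sentence entailed by $\mathsf{PRA}^2$ is entailed by $\mathsf{PRA}^2+\mathsf{BCT}$, every sentence entailed by $\mathsf{PRA}^2+\mathsf{BCT}$ is entailed by $\mathsf{RCA}_0$, and neither converse holds. 2. There is a uniformly primitive recursive sequence $(V_n)_{n\in\omega}$ of dense open sets in $\omega^\omega$ (that is, there is a primitive recursive map $(n,k)\mapsto\sigma_{n,k}\in\omega^{<\omega}$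 such that $V_n$ is the set of all functions that extend $\sigma_{n,k}$ for some $k$) such that no primitive recursive function lies in $\bigcap_n V_n$. 3. There are a computable function $f\colon\omega\to\omega$ and an $\omega$-model $\mathcal K$ of $\mathsf{PRA}^2+\mathsf{BCT}$ such that no $g\in\mathcal K$ satisfies $f(n)\le g(n)$ for all but finitely many $n$. -/

import Mathlib

namespace SecondOrderPRA

/-! ### Primitive recursive schemes -/

/-- Schemes for primitive recursive functionals with `k` unary function arguments `f₀, …, f_{k-1}`
and `n` number arguments. The schemes with `k = 0` define the primitive recursive functions. -/
inductive Scheme (k : ℕ) : ℕ → Type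
  | zero {n : ℕ} : Scheme k n
  | succ : Scheme k 1
  | proj {n : ℕ} (i : Fin n) : Scheme k n
  | oracle (i : Fin k) : Scheme k 1
  | comp {m n : ℕ} (P : Scheme k m) (Q : Fin m → Scheme k n) : Scheme k n
  | prec {n : ℕ} (P : Scheme k n) (Q : Scheme k (n + 2)) : Scheme k (n + 1)

namespace Scheme

/-- The functional on the standard natural numbers that is defined by a scheme. -/
def eval {k : ℕ} (fs : Fin k → ℕ → ℕ) : {n : ℕ} → Scheme k n → (Fin n → ℕ) → ℕ
  | _, zero, _ => 0
  | _, succ, x => x 0 + 1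
  | _, proj i, x => x i
  | _, oracle i, x => fs i (x 0)
  | _, comp P Q, x => P.eval fs (fun j => (Q j).eval fs x)
  | _, prec P Q, x =>
      Nat.rec (P.eval fs (Fin.tail x))
        (fun y r => Q.eval fs (Fin.cons y (Fin.cons r (Fin.tail x)))) (x 0)

variable {k : ℕ}

/-- `add (x, y) = x + y`. -/
def add : Scheme k 2 := prec (proj 0) (comp succ ![proj 1])

/-- `pred x = x ∸ 1`. -/
def pred : Scheme k 1 := prec zero (proj 0)

/-- Truncated subtraction with the arguments in reversed order: `monus (x, y) = y ∸ x`. -/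
def monus : Scheme k 2 := prec (proj 0) (comp pred ![proj 1])

/-- `isZero x = 1` if `x = 0`, and `isZero x = 0` otherwise. -/
def isZero : Scheme k 1 := prec (comp succ ![zero]) zero

/-- Triangular numbers, `tri x = 0 + 1 + ⋯ + x`. -/
def tri : Scheme k 1 := prec zero (comp add ![proj 1, comp succ ![proj 0]])

/-- The Cantor pairing function, `pair (x, y) = tri (x + y) + x`. -/
def pair : Scheme k 2 := comp add ![comp tri ![add], proj 0]

/-- `diag z` is the largest `d` with `tri d ≤ z`, so that `diag (pair (x, y)) = x + y`. -/
def diag : Scheme k 1 :=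
  prec zero (comp add ![proj 1,
    comp isZero ![comp monus ![comp succ ![proj 0], comp tri ![comp succ ![proj 1]]]]])

/-- First projection of the pairing function. -/
def fst : Scheme k 1 := comp monus ![comp tri ![diag], proj 0]

/-- Second projection of the pairing function. -/
def snd : Scheme k 1 := comp monus ![fst, diag]

/-! Finite strings of numbers are coded by numbers: `0` is the code of the empty string, and
`pair (c, a) + 1` is the code of `σ⌢a` if `c` is the code of `σ`. Every number is the code of
exactly one string. -/

/-- `init c` codes the string coded by `c` without its last entry. -/
def init : Scheme k 1 := comp fst ![pred]

/-- `drop (j, c)` codes the string coded by `c` without its last `j` entries. -/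
def drop : Scheme k 2 := prec (proj 0) (comp init ![proj 1])

/-- `restrict h l` codes the string `h(0) h(1) ⋯ h(l-1)`. -/
def restrict : Scheme 1 1 :=
  prec zero (comp succ ![comp pair ![proj 1, comp (oracle 0) ![proj 0]]])

end Scheme

/-! ### The two-sorted language -/

/-- Number terms with `p` free function variables and `m` free number variables. There is a symbol
`sym P` for each scheme `P`. -/
inductive Tm (p m : ℕ) : Type
  | var (i : Fin m) : Tm p m
  | zero : Tm p m
  | succ (t : Tm p m) : Tm p m
  | app (f : Fin p) (t : Tm p m) : Tm p m
  | sym {k n : ℕ} (P : Scheme k n) (fs : Fin k → Fin p) (ts : Fin n → Tm p m) : Tm p m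

/-- Simultaneous renaming of the function variables and substitution for the number variables. -/
def Tm.subst {p m p' m' : ℕ} (ρ : Fin p → Fin p') (σ : Fin m → Tm p' m') : Tm p m → Tm p' m'
  | var i => σ i
  | zero => zero
  | succ t => succ (t.subst ρ σ)
  | app f t => app (ρ f) (t.subst ρ σ)
  | sym P fs ts => sym P (fun i => ρ (fs i)) (fun i => (ts i).subst ρ σ)

/-- Weakening by a new number variable, which gets the index `0`. -/
def Tm.liftN {p m : ℕ} (t : Tm p m) : Tm p (m + 1) := t.subst id (fun i => .var i.succ)

/-- Weakening by a new function variable, which gets the index `0`. -/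
def Tm.liftF {p m : ℕ} (t : Tm p m) : Tm (p + 1) m := t.subst Fin.succ .var

/-- Formulas with `p` free function variables and `m` free number variables. The quantifiers
`allN`, `exN` over numbers and `allF`, `exF` over functions bind the variable with index `0`. -/
inductive Fml : ℕ → ℕ → Type
  | eq {p m : ℕ} (s t : Tm p m) : Fml p m
  | lt {p m : ℕ} (s t : Tm p m) : Fml p m
  | neg {p m : ℕ} (φ : Fml p m) : Fml p m
  | and {p m : ℕ} (φ ψ : Fml p m) : Fml p m
  | or {p m : ℕ} (φ ψ : Fml p m) : Fml p m
  | imp {p m : ℕ} (φ ψ : Fml p m) : Fml p m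
  | allN {p m : ℕ} (φ : Fml p (m + 1)) : Fml p m
  | exN {p m : ℕ} (φ : Fml p (m + 1)) : Fml p m
  | allF {p m : ℕ} (φ : Fml (p + 1) m) : Fml p m
  | exF {p m : ℕ} (φ : Fml (p + 1) m) : Fml p m

namespace Fml

/-- Capture-avoiding substitution in formulas. -/
def subst : {p m p' m' : ℕ} → (Fin p → Fin p') → (Fin m → Tm p' m') → Fml p m → Fml p' m'
  | _, _, _, _, ρ, σ, eq s t => eq (s.subst ρ σ) (t.subst ρ σ)
  | _, _, _, _, ρ, σ, lt s t => lt (s.subst ρ σ) (t.subst ρ σ)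
  | _, _, _, _, ρ, σ, neg φ => neg (φ.subst ρ σ)
  | _, _, _, _, ρ, σ, and φ ψ => and (φ.subst ρ σ) (ψ.subst ρ σ)
  | _, _, _, _, ρ, σ, or φ ψ => or (φ.subst ρ σ) (ψ.subst ρ σ)
  | _, _, _, _, ρ, σ, imp φ ψ => imp (φ.subst ρ σ) (ψ.subst ρ σ)
  | _, _, _, _, ρ, σ, allN φ => allN (φ.subst ρ (Fin.cons (.var 0) fun i => (σ i).liftN))
  | _, _, _, _, ρ, σ, exN φ => exN (φ.subst ρ (Fin.cons (.var 0) fun i => (σ i).liftN))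
  | _, _, _, _, ρ, σ, allF φ =>
      allF (φ.subst (Fin.cons 0 fun i => (ρ i).succ) fun i => (σ i).liftF)
  | _, _, _, _, ρ, σ, exF φ =>
      exF (φ.subst (Fin.cons 0 fun i => (ρ i).succ) fun i => (σ i).liftF)

/-- Quantifier-free formulas. -/
def IsQF : {p m : ℕ} → Fml p m → Prop
  | _, _, eq _ _ => True
  | _, _, lt _ _ => True
  | _, _, neg φ => φ.IsQF
  | _, _, and φ ψ => φ.IsQF ∧ ψ.IsQF
  | _, _, or φ ψ => φ.IsQF ∧ ψ.IsQF
  | _, _, imp φ ψ => φ.IsQF ∧ ψ.IsQF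
  | _, _, allN _ => False
  | _, _, exN _ => False
  | _, _, allF _ => False
  | _, _, exF _ => False

/-- `φ ↔ ψ`. -/
def iff {p m : ℕ} (φ ψ : Fml p m) : Fml p m := and (imp φ ψ) (imp ψ φ)

/-- Universal closure with respect to the number variables. -/
def closeN {p : ℕ} : {m : ℕ} → Fml p m → Fml p 0
  | 0, φ => φ
  | _ + 1, φ => closeN (allN φ)

/-- Universal closure with respect to the function variables. -/
def closeF : {p : ℕ} → Fml p 0 → Fml 0 0
  | 0, φ => φ
  | _ + 1, φ => closeF (allF φ)

/-- Universal closure. -/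
def close {p m : ℕ} (φ : Fml p m) : Fml 0 0 := closeF (closeN φ)

end Fml

/-- Sentences of the language. -/
abbrev Sentence : Type := Fml 0 0

/-- Theories are sets of sentences. -/
abbrev Theory : Type := Set Sentence

/-! ### Structures and satisfaction -/

/-- Structures for the language: a first-order universe `N`, a set `F` of functions from `N` to `N`
as the range of the function variables, and interpretations of all the symbols. -/
structure Model where
  N : Type
  F : Set (N → N)
  zero : N
  succ : N → N
  lt : N → N → Prop
  sym : {k n : ℕ} → Scheme k n → (Fin k → F) → (Fin n → N) → N

namespace Model

/-- The value of a term. -/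
def val (M : Model) {p m : ℕ} (e : Fin p → M.F) (v : Fin m → M.N) : Tm p m → M.N
  | .var i => v i
  | .zero => M.zero
  | .succ t => M.succ (M.val e v t)
  | .app f t => (e f).1 (M.val e v t)
  | .sym P fs ts => M.sym P (fun i => e (fs i)) (fun i => M.val e v (ts i))

/-- Tarski's satisfaction relation. -/
def Sat (M : Model) : {p m : ℕ} → (Fin p → M.F) → (Fin m → M.N) → Fml p m → Prop
  | _, _, e, v, .eq s t => M.val e v s = M.val e v t
  | _, _, e, v, .lt s t => M.lt (M.val e v s) (M.val e v t)
  | _, _, e, v, .neg φ => ¬ M.Sat e v φ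
  | _, _, e, v, .and φ ψ => M.Sat e v φ ∧ M.Sat e v ψ
  | _, _, e, v, .or φ ψ => M.Sat e v φ ∨ M.Sat e v ψ
  | _, _, e, v, .imp φ ψ => M.Sat e v φ → M.Sat e v ψ
  | _, _, e, v, .allN φ => ∀ a : M.N, M.Sat e (Fin.cons a v : Fin _ → M.N) φ
  | _, _, e, v, .exN φ => ∃ a : M.N, M.Sat e (Fin.cons a v : Fin _ → M.N) φ
  | _, _, e, v, .allF φ => ∀ f : M.F, M.Sat (Fin.cons f e : Fin _ → M.F) v φ
  | _, _, e, v, .exF φ => ∃ f : M.F, M.Sat (Fin.cons f e : Fin _ → M.F) v φ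

/-- `φ` is true in `M`. -/
def Realizes (M : Model) (φ : Sentence) : Prop := M.Sat Fin.elim0 Fin.elim0 φ

/-- `M` is a model of the theory `T`. -/
def Models (M : Model) (T : Theory) : Prop := ∀ φ ∈ T, M.Realizes φ

end Model

/-- The `ω`-structure whose function variables range over the set `K`: the first-order part is the
standard model of arithmetic and every symbol has its standard meaning. -/
def omega (K : Set (ℕ → ℕ)) : Model where
  N := ℕ
  F := K
  zero := 0
  succ := Nat.succ
  lt := (· < ·)
  sym P fs x := P.eval (fun i => (fs i).1) x

/-- `φ` is a consequence of the theory `T`. -/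
def Theory.Entails (T : Theory) (φ : Sentence) : Prop := ∀ M : Model, M.Models T → M.Realizes φ

/-- `T` lies strictly below `T'`: all consequences of `T` are consequences of `T'`, but not
conversely. -/
def Theory.StrictlyBelow (T T' : Theory) : Prop :=
  (∀ φ, T.Entails φ → T'.Entails φ) ∧ ∃ φ, T'.Entails φ ∧ ¬ T.Entails φ

/-! ### The axiom systems -/

open Fml Tm in
/-- The axioms of `PRA²`. -/
inductive PRA2 : Theory
  /-- `0 ≠ s(x)` -/
  | zero_ne_succ : PRA2 (close (p := 0) (m := 1) (neg (eq .zero (.succ (var 0)))))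
  /-- `s(x) = s(y) → x = y` -/
  | succ_inj : PRA2 (close (p := 0) (m := 2)
      (imp (eq (.succ (var 0)) (.succ (var 1))) (eq (var 0) (var 1))))
  /-- `¬ x < 0` -/
  | not_lt_zero : PRA2 (close (p := 0) (m := 1) (neg (lt (var 0) .zero)))
  /-- `x < s(y) ↔ x < y ∨ x = y` -/
  | lt_succ : PRA2 (close (p := 0) (m := 2)
      (iff (lt (var 0) (.succ (var 1))) (or (lt (var 0) (var 1)) (eq (var 0) (var 1)))))
  /-- The defining equations of the primitive recursive functions and functionals are given by
  this axiom and the next six. -/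
  | sym_zero (k n : ℕ) : PRA2 (close (p := k) (m := n)
      (eq (sym (Scheme.zero : Scheme k n) id var) .zero))
  | sym_succ (k : ℕ) : PRA2 (close (p := k) (m := 1)
      (eq (sym (Scheme.succ : Scheme k 1) id var) (.succ (var 0))))
  | sym_proj (k n : ℕ) (i : Fin n) : PRA2 (close (p := k) (m := n)
      (eq (sym (Scheme.proj i : Scheme k n) id var) (var i)))
  | sym_oracle (k : ℕ) (i : Fin k) : PRA2 (close (p := k) (m := 1)
      (eq (sym (Scheme.oracle i) id var) (app i (var 0))))
  | sym_comp (k m n : ℕ) (P : Scheme k m) (Q : Fin m → Scheme k n) :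
      PRA2 (close (p := k) (m := n)
        (eq (sym (Scheme.comp P Q) id var) (sym P id fun j => sym (Q j) id var)))
  /-- `R(f, 0, x) = P(f, x)` for `R = prec P Q` -/
  | sym_prec_zero (k n : ℕ) (P : Scheme k n) (Q : Scheme k (n + 2)) :
      PRA2 (close (p := k) (m := n)
        (eq (sym (Scheme.prec P Q) id (Fin.cons .zero var)) (sym P id var)))
  /-- `R(f, s(y), x) = Q(f, y, R(f, y, x), x)` for `R = prec P Q` -/
  | sym_prec_succ (k n : ℕ) (P : Scheme k n) (Q : Scheme k (n + 2)) :
      PRA2 (close (p := k) (m := n + 1)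
        (eq (sym (Scheme.prec P Q) id (Fin.cons (.succ (var 0)) fun i => var i.succ))
          (sym Q id (Fin.cons (var 0) (Fin.cons (sym (Scheme.prec P Q) id var)
            fun i => var i.succ)))))
  /-- For all functions `f` and numbers `a` there is a function `g` with `g(x) = P(f, x, a)` for
  all `x`. -/
  | functional (k n : ℕ) (P : Scheme k (n + 1)) : PRA2 (close (p := k) (m := n)
      (exF (allN (eq (app 0 (var 0)) (sym P Fin.succ var)))))
  /-- Induction for quantifier-free formulas with parameters of both sorts. -/
  | induction (p m : ℕ) (θ : Fml p (m + 1)) (hθ : θ.IsQF) : PRA2 (close (p := p) (m := m)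
      (imp
        (and (θ.subst id (Fin.cons .zero var))
          (allN (imp θ (θ.subst id (Fin.cons (.succ (var 0)) fun i => var i.succ)))))
        (allN θ)))

open Fml Tm in
/-- The schema `QF-AC`, `∀ n ∃ m θ(n, m) → ∃ f ∀ n θ(n, f(n))` for quantifier-free `θ` with
parameters of both sorts. In `θ` the variable with index `0` is `m`, and that with index `1`
is `n`. -/
inductive QFAC : Theory
  | choice (p l : ℕ) (θ : Fml p (l + 2)) (hθ : θ.IsQF) : QFAC (close (p := p) (m := l)
      (imp (allN (exN θ))
        (exF (allN (θ.subst Fin.succ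
          (Fin.cons (app 0 (var 0)) (Fin.cons (var 0) fun i => var i.succ)))))))

/-- `RCA₀` in the language of functions. -/
def RCA0 : Theory := PRA2 ∪ QFAC

namespace Fml

/-- The string coded by `s` is an initial segment of the string coded by `t`. -/
def initSeg {p m : ℕ} (s t : Tm p m) : Fml p m :=
  exN (eq (.sym (Scheme.drop : Scheme 0 2) ![] ![.var 0, t.liftN]) s.liftN)

/-- The function `h` extends the string coded by `s`. -/
def extendsStr {p m : ℕ} (h : Fin p) (s : Tm p m) : Fml p m :=
  exN (eq (.sym Scheme.restrict ![h] ![.var 0]) s.liftN)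

/-- The `k`-th string in the list for the `n`-th open set, `V(⟨n, k⟩)`. -/
def entry {p m : ℕ} (V : Fin p) (n k : Tm p m) : Tm p m :=
  .app V (.sym (Scheme.pair : Scheme 0 2) ![] ![n, k])

/-- All the open sets listed by `V` are dense: `∀ n ∀ σ ∃ τ ∃ k (σ ≼ τ ∧ V(⟨n, k⟩) ≼ τ)`. -/
def denseSeq {p : ℕ} (V : Fin p) : Fml p 0 :=
  allN (allN (exN (exN
    (and (initSeg (.var 2) (.var 1)) (initSeg (entry V (.var 3) (.var 0)) (.var 1))))))

/-- The function `h` is in all the open sets listed by `V`: `∀ n ∃ k (V(⟨n, k⟩) ≺ h)`. -/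
def memAll {p : ℕ} (h V : Fin p) : Fml p 0 :=
  allN (exN (extendsStr h (entry V (.var 1) (.var 0))))

end Fml

/-- The Baire category theorem for the space of all functions. -/
def BCT : Sentence := .allF (.imp (.denseSeq 0) (.exF (.memAll 0 1)))

/-! ### Open sets in the standard Baire space -/

/-- The basic open set of all functions that extend the string `σ`. -/
def basicOpen (σ : List ℕ) : Set (ℕ → ℕ) := {h | List.ofFn (fun i : Fin σ.length => h i) = σ}

/-- The open set that is coded by the sequence `W` of strings. -/
def openSet (W : ℕ → List ℕ) : Set (ℕ → ℕ) := ⋃ k, basicOpen (W k)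

end SecondOrderPRA

open SecondOrderPRA

/-!
Both strictness claims and the two statements about the standard model rest on one observation: the
diagonal `n ↦ ack n n` of the Ackermann function dominates every primitive recursive function, while
the relation "`m` codes a halting computation with input `j` and output `ack j j`" is primitive
recursive (`exists_primrecRel_ack_le`).

*Open sets without primitive recursive points.* For every `N`, the functions `h` such that `h j`
codes a computation of `ack j j` for some `j ≥ N` form a dense open set, and a function in all these
sets is not dominated by the diagonal. To list strings for such a set in a primitive recursive way
one needs a default string in it. Therefore the index of the set contains a candidate `t` for a
computation of `ack N N`, and the set is the whole space if `t` is not one (`diagSeq`). Transferred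
to codes of strings, this refutes `BCT` in the `ω`-model of all primitive recursive functions.

*An `ω`-model of `BCT` without dominating functions.* Suppose that no function primitive recursive
in `h₀, …, h_{s-1}` dominates `ack n n`, and let `h_s` be generic. Then `h_s` is in all the dense
open sets coded by those countably many functions. If `P` is a functional, then `P(h₀, …, h_s)`
still does not dominate: a finite condition on `h_s` is satisfied by an eventually vanishing
function, for which the value of `P` is primitive recursive in the earlier functions and hence drops
below `ack n n` somewhere, and by continuity a longer finite condition forces this. The Baire
category theorem of the metatheory gives `h_s` (`exists_generic`), and all the functions that are
primitive recursive in finitely many of the `h_s` form the model (`exists_omega_models_BCT`). In it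
the instance of `QF-AC` for computations of `ack n n` fails (`exists_QFAC_not_realizes_omega`).

*`RCA₀` proves `BCT`.* Here arbitrary, possibly nonstandard models have to be considered. Predicates
given by quantifier-free formulas are treated semantically (`QFPred`), so that induction and choice
become principles about predicates on the universe of the model. With `QF-AC` one chooses an
extension of every string into every open set; iterating this yields an increasing sequence of
strings, and its limit is the required function (`Model.exists_limit`).
-/

namespace SecondOrderPRA

namespace Model

variable {M : Model}

/-! ### Substitution, universal closure and definability -/

theorem val_subst {p m p' m' : ℕ} (ρ : Fin p → Fin p') (σ : Fin m → Tm p' m')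
    (e : Fin p' → M.F) (v : Fin m' → M.N) (t : Tm p m) :
    M.val e v (t.subst ρ σ) = M.val (fun i => e (ρ i)) (fun i => M.val e v (σ i)) t := by
  induction t with
  | var i => rfl
  | zero => rfl
  | succ t ih => simp [Tm.subst, val, ih]
  | app f t ih => simp [Tm.subst, val, ih]
  | sym P fs ts ih => simp [Tm.subst, val, ih]

theorem sat_subst_of_isQF {p m p' m' : ℕ} (ρ : Fin p → Fin p') (σ : Fin m → Tm p' m')
    (e : Fin p' → M.F) (v : Fin m' → M.N) (φ : Fml p m) (hφ : φ.IsQF) :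
    M.Sat e v (φ.subst ρ σ) ↔ M.Sat (fun i => e (ρ i)) (fun i => M.val e v (σ i)) φ := by
  induction φ with
  | eq s t => simp [Fml.subst, Sat, val_subst]
  | lt s t => simp [Fml.subst, Sat, val_subst]
  | neg φ ih => simp [Fml.subst, Sat, ih ρ σ hφ]
  | and φ ψ ih ih' => simp [Fml.subst, Sat, ih ρ σ hφ.1, ih' ρ σ hφ.2]
  | or φ ψ ih ih' => simp [Fml.subst, Sat, ih ρ σ hφ.1, ih' ρ σ hφ.2]
  | imp φ ψ ih ih' => simp [Fml.subst, Sat, ih ρ σ hφ.1, ih' ρ σ hφ.2]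
  | allN => exact hφ.elim
  | exN => exact hφ.elim
  | allF => exact hφ.elim
  | exF => exact hφ.elim

theorem sat_closeN {p m : ℕ} (e : Fin p → M.F) (φ : Fml p m) :
    M.Sat e Fin.elim0 φ.closeN ↔ ∀ v, M.Sat e v φ := by
  induction m with
  | zero => simp [Fml.closeN, Unique.forall_iff, Subsingleton.elim default (Fin.elim0 : _ → M.N)]
  | succ m ih =>
    rw [Fml.closeN, ih]
    exact ⟨fun h v => Fin.cons_self_tail v ▸ h (Fin.tail v) (v 0), fun h v a => h _⟩

theorem sat_closeF {p : ℕ} (φ : Fml p 0) :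
    M.Realizes φ.closeF ↔ ∀ e, M.Sat e Fin.elim0 φ := by
  induction p with
  | zero =>
    simp [Fml.closeF, Unique.forall_iff, Realizes,
      Subsingleton.elim default (Fin.elim0 : _ → M.F)]
  | succ m ih =>
    rw [Fml.closeF, ih]
    exact ⟨fun h v => Fin.cons_self_tail v ▸ h (Fin.tail v) (v 0), fun h v a => h _⟩

theorem realizes_close {p m : ℕ} (φ : Fml p m) :
    M.Realizes φ.close ↔ ∀ e v, M.Sat e v φ := by
  simp only [Fml.close, sat_closeF, sat_closeN]

/-- The functions of two number variables that are given by terms with arbitrary parameters of both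
sorts. Working with such functions instead of terms makes it unnecessary to keep track of the
indices of variables. -/
inductive TermFun (M : Model) : (M.N × M.N → M.N) → Prop
  | left : TermFun M fun q => q.1
  | right : TermFun M fun q => q.2
  | const (a : M.N) : TermFun M fun _ => a
  | succ {f : M.N × M.N → M.N} (hf : TermFun M f) : TermFun M fun q => M.succ (f q)
  | app (g : M.F) {f : M.N × M.N → M.N} (hf : TermFun M f) : TermFun M fun q => g.1 (f q)
  | sym {k n : ℕ} (P : Scheme k n) (fs : Fin k → M.F) (ts : Fin n → M.N × M.N → M.N)
      (h : ∀ i, TermFun M (ts i)) : TermFun M fun q => M.sym P fs fun i => ts i q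

/-- The binary predicates that are given by quantifier-free formulas without `<` and with arbitrary
parameters of both sorts. -/
inductive QFPred (M : Model) : (M.N × M.N → Prop) → Prop
  | eq {f g : M.N × M.N → M.N} (hf : TermFun M f) (hg : TermFun M g) :
      QFPred M fun q => f q = g q
  | not {A : M.N × M.N → Prop} (hA : QFPred M A) : QFPred M fun q => ¬ A q
  | and {A B : M.N × M.N → Prop} (hA : QFPred M A) (hB : QFPred M B) :
      QFPred M fun q => A q ∧ B q
  | or {A B : M.N × M.N → Prop} (hA : QFPred M A) (hB : QFPred M B) :
      QFPred M fun q => A q ∨ B q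
  | imp {A B : M.N × M.N → Prop} (hA : QFPred M A) (hB : QFPred M B) :
      QFPred M fun q => A q → B q

attribute [simp] TermFun.left TermFun.right TermFun.const TermFun.succ TermFun.app
  QFPred.eq QFPred.not QFPred.and QFPred.or QFPred.imp

/-- `Covers A B e v`: the assignments `e` and `v` provide variables for the two arguments, for the
number parameters in `A` and for the function parameters in `B`. -/
structure Covers (A : Set M.N) (B : Set M.F) {p m : ℕ}
    (e : Fin p → M.F) (v : M.N × M.N → Fin m → M.N) : Prop where
  fst : ∃ i, ∀ q, v q i = q.1
  snd : ∃ i, ∀ q, v q i = q.2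
  num : ∀ a ∈ A, ∃ i, ∀ q, v q i = a
  fn : ∀ f ∈ B, ∃ j, e j = f

theorem Covers.mono {A A' : Set M.N} {B B' : Set M.F} {p m : ℕ}
    {e : Fin p → M.F} {v : M.N × M.N → Fin m → M.N} (h : Covers A B e v) (hA : A' ⊆ A)
    (hB : B' ⊆ B) :
    Covers A' B' e v :=
  ⟨h.fst, h.snd, fun a ha => h.num a (hA ha), fun f hf => h.fn f (hB hf)⟩

/-- Finitely many parameters suffice, and it does not matter which variables are assigned to
them; this is what allows terms with different parameters to be combined. -/
theorem TermFun.exists_tm {f : M.N × M.N → M.N} (hf : M.TermFun f) :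
    ∃ (A : Set M.N) (B : Set M.F), A.Finite ∧ B.Finite ∧
      ∀ {p m : ℕ} (e : Fin p → M.F) (v : M.N × M.N → Fin m → M.N), Covers A B e v →
        ∃ t : Tm p m, ∀ x, M.val e (v x) t = f x := by
  induction hf with
  | left =>
    exact ⟨∅, ∅, Set.finite_empty, Set.finite_empty, fun e v h =>
      let ⟨i, hi⟩ := h.fst; ⟨.var i, hi⟩⟩
  | right =>
    exact ⟨∅, ∅, Set.finite_empty, Set.finite_empty, fun e v h =>
      let ⟨i, hi⟩ := h.snd; ⟨.var i, hi⟩⟩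
  | const a =>
    exact ⟨{a}, ∅, Set.finite_singleton a, Set.finite_empty, fun e v h =>
      let ⟨i, hi⟩ := h.num a rfl; ⟨.var i, hi⟩⟩
  | succ _ ih =>
    obtain ⟨A, B, hA, hB, h⟩ := ih
    refine ⟨A, B, hA, hB, fun e v hev => ?_⟩
    obtain ⟨t, ht⟩ := h e v hev
    exact ⟨.succ t, fun x => by rw [val, ht]⟩
  | app g _ ih =>
    obtain ⟨A, B, hA, hB, h⟩ := ih
    refine ⟨A, insert g B, hA, hB.insert g, fun e v hev => ?_⟩
    obtain ⟨t, ht⟩ := h e v (hev.mono subset_rfl (Set.subset_insert g B))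
    obtain ⟨j, hj⟩ := hev.fn g (Set.mem_insert g B)
    exact ⟨.app j t, fun x => by rw [val, ht, hj]⟩
  | sym P fs ts _ ih =>
    choose A B hA hB h using ih
    refine ⟨⋃ i, A i, Set.range fs ∪ ⋃ i, B i, Set.finite_iUnion hA,
      (Set.finite_range fs).union (Set.finite_iUnion hB), fun e v hev => ?_⟩
    choose t ht using fun i => h i e v (hev.mono (Set.subset_iUnion A i)
      ((Set.subset_iUnion B i).trans Set.subset_union_right))
    choose j hj using fun i => hev.fn (fs i) (.inl ⟨i, rfl⟩)
    exact ⟨.sym P j t, fun x => by simp [val, ht, hj]⟩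

theorem QFPred.exists_fml {Q : M.N × M.N → Prop} (hQ : M.QFPred Q) :
    ∃ (A : Set M.N) (B : Set M.F), A.Finite ∧ B.Finite ∧
      ∀ {p m : ℕ} (e : Fin p → M.F) (v : M.N × M.N → Fin m → M.N), Covers A B e v →
        ∃ θ : Fml p m, θ.IsQF ∧ ∀ x, M.Sat e (v x) θ ↔ Q x := by
  induction hQ with
  | eq hf hg =>
    obtain ⟨A, B, hA, hB, h⟩ := hf.exists_tm
    obtain ⟨A', B', hA', hB', h'⟩ := hg.exists_tm
    refine ⟨A ∪ A', B ∪ B', hA.union hA', hB.union hB', fun e v hev => ?_⟩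
    obtain ⟨s, hs⟩ := h e v (hev.mono Set.subset_union_left Set.subset_union_left)
    obtain ⟨t, ht⟩ := h' e v (hev.mono Set.subset_union_right Set.subset_union_right)
    exact ⟨.eq s t, trivial, fun x => by rw [Sat, hs, ht]⟩
  | not _ ih =>
    obtain ⟨A, B, hA, hB, h⟩ := ih
    refine ⟨A, B, hA, hB, fun e v hev => ?_⟩
    obtain ⟨θ, hθ, hs⟩ := h e v hev
    exact ⟨.neg θ, hθ, fun x => by rw [Sat, hs]⟩
  | and _ _ ih ih' =>
    obtain ⟨A, B, hA, hB, h⟩ := ih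
    obtain ⟨A', B', hA', hB', h'⟩ := ih'
    refine ⟨A ∪ A', B ∪ B', hA.union hA', hB.union hB', fun e v hev => ?_⟩
    obtain ⟨s, hs₁, hs⟩ := h e v (hev.mono Set.subset_union_left Set.subset_union_left)
    obtain ⟨t, ht₁, ht⟩ := h' e v (hev.mono Set.subset_union_right Set.subset_union_right)
    exact ⟨.and s t, ⟨hs₁, ht₁⟩, fun x => by rw [Sat, hs, ht]⟩
  | or _ _ ih ih' =>
    obtain ⟨A, B, hA, hB, h⟩ := ih
    obtain ⟨A', B', hA', hB', h'⟩ := ih'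
    refine ⟨A ∪ A', B ∪ B', hA.union hA', hB.union hB', fun e v hev => ?_⟩
    obtain ⟨s, hs₁, hs⟩ := h e v (hev.mono Set.subset_union_left Set.subset_union_left)
    obtain ⟨t, ht₁, ht⟩ := h' e v (hev.mono Set.subset_union_right Set.subset_union_right)
    exact ⟨.or s t, ⟨hs₁, ht₁⟩, fun x => by rw [Sat, hs, ht]⟩
  | imp _ _ ih ih' =>
    obtain ⟨A, B, hA, hB, h⟩ := ih
    obtain ⟨A', B', hA', hB', h'⟩ := ih'
    refine ⟨A ∪ A', B ∪ B', hA.union hA', hB.union hB', fun e v hev => ?_⟩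
    obtain ⟨s, hs₁, hs⟩ := h e v (hev.mono Set.subset_union_left Set.subset_union_left)
    obtain ⟨t, ht₁, ht⟩ := h' e v (hev.mono Set.subset_union_right Set.subset_union_right)
    exact ⟨.imp s t, ⟨hs₁, ht₁⟩, fun x => by rw [Sat, hs, ht]⟩

theorem exists_fin_enum {α : Type} {A : Set α} (hA : A.Finite) :
    ∃ (n : ℕ) (e : Fin n → α), ∀ a ∈ A, ∃ i, e i = a := by
  have := hA.to_subtype
  obtain ⟨n, ⟨e⟩⟩ := Finite.exists_equiv_fin A
  exact ⟨n, fun i => (e.symm i).1, fun a ha => ⟨e ⟨a, ha⟩, by simp⟩⟩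

/-- Induction in models of `PRA²` for predicates that are given by quantifier-free formulas. -/
theorem QFPred.induction (hM : M.Models PRA2) {Q : M.N → Prop} (hQ : M.QFPred fun q => Q q.1)
    (h0 : Q M.zero) (hs : ∀ x, Q x → Q (M.succ x)) (x : M.N) : Q x := by
  obtain ⟨A, B, hA, hB, h⟩ := hQ.exists_fml
  obtain ⟨m, v, hv⟩ := exists_fin_enum hA
  obtain ⟨p, e, he⟩ := exists_fin_enum hB
  obtain ⟨θ, hθ, hθQ⟩ := h e
    (fun q => (Fin.cons q.1 (Fin.cons q.2 v : Fin (m + 1) → M.N) : Fin (m + 2) → M.N))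
    ⟨⟨0, fun _ => rfl⟩, ⟨1, fun _ => rfl⟩,
      fun a ha => let ⟨i, hi⟩ := hv a ha; ⟨i.succ.succ, fun _ => hi⟩, he⟩
  -- The second argument is irrelevant and becomes one more parameter.
  set w : Fin (m + 1) → M.N := Fin.cons M.zero v
  replace hθQ (a : M.N) : M.Sat e (Fin.cons a w : Fin (m + 2) → M.N) θ ↔ Q a := hθQ (a, M.zero)
  have key := (realizes_close _).1 (hM _ (PRA2.induction p (m + 1) θ hθ)) e w
  have e1 : (fun i => M.val e w ((Fin.cons .zero .var : Fin (m + 2) → Tm p (m + 1)) i))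
      = Fin.cons M.zero w := by
    funext i; refine Fin.cases rfl (fun i => rfl) i
  have e2 (a : M.N) : (fun i => M.val e (Fin.cons a w : Fin (m + 2) → M.N)
      ((Fin.cons (.succ (.var 0)) fun i => .var i.succ : Fin (m + 2) → Tm p (m + 2)) i))
      = Fin.cons (M.succ a) w := by
    funext i; refine Fin.cases rfl (fun i => rfl) i
  simp only [Sat, sat_subst_of_isQF _ _ _ _ θ hθ, e1, e2, id, hθQ] at key
  exact key ⟨h0, hs⟩ x

/-- Choice in models of `RCA₀` for predicates that are given by quantifier-free formulas. -/
theorem QFPred.choice (hM : M.Models RCA0) {Q : M.N → M.N → Prop}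
    (hQ : M.QFPred fun q => Q q.1 q.2)
    (h : ∀ x, ∃ y, Q x y) : ∃ f : M.F, ∀ x, Q x (f.1 x) := by
  obtain ⟨A, B, hA, hB, hAB⟩ := hQ.exists_fml
  obtain ⟨m, v, hv⟩ := exists_fin_enum hA
  obtain ⟨p, e, he⟩ := exists_fin_enum hB
  obtain ⟨θ, hθ, hθQ⟩ := hAB e
    (fun q => (Fin.cons q.2 (Fin.cons q.1 v : Fin (m + 1) → M.N) : Fin (m + 2) → M.N))
    ⟨⟨1, fun _ => rfl⟩, ⟨0, fun _ => rfl⟩,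
      fun a ha => let ⟨i, hi⟩ := hv a ha; ⟨i.succ.succ, fun _ => hi⟩, he⟩
  have key := (realizes_close _).1 (hM _ (.inr (QFAC.choice p m θ hθ))) e v
  have e1 (f : M.F) (a : M.N) : (fun i => M.val (Fin.cons f e : Fin (p + 1) → M.F)
      (Fin.cons a v : Fin (m + 1) → M.N)
      ((Fin.cons (.app 0 (.var 0)) (Fin.cons (.var 0) fun i => .var i.succ) :
        Fin (m + 2) → Tm (p + 1) (m + 1)) i))
      = Fin.cons (f.1 a) (Fin.cons a v : Fin (m + 1) → M.N) := by
    funext i; refine Fin.cases rfl (fun i => Fin.cases rfl (fun i => rfl) i) i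
  simp only [Sat, sat_subst_of_isQF _ _ _ _ θ hθ, e1, Fin.cons_succ] at key
  obtain ⟨f, hf⟩ := key fun x => let ⟨y, hy⟩ := h x; ⟨y, (hθQ (x, y)).2 hy⟩
  exact ⟨f, fun x => (hθQ (x, f.1 x)).1 (hf x)⟩

end Model

/-! ### Arithmetic in models of `PRA²` -/

namespace Model

/-- `M` is a model of `PRA²`. -/
class IsPRA (M : Model) : Prop where
  models : M.Models PRA2

variable {M : Model}

/-! Sums and differences in `M` are the values of the symbols for the schemes `add` and `monus`. -/

instance : Zero M.N := ⟨M.zero⟩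
instance : One M.N := ⟨M.succ M.zero⟩
instance : Add M.N := ⟨fun x y => M.sym Scheme.add Fin.elim0 ![x, y]⟩
/-- Truncated subtraction. -/
instance : Sub M.N := ⟨fun y x => M.sym Scheme.monus Fin.elim0 ![x, y]⟩

/-- The truncated predecessor. -/
def pred (x : M.N) : M.N := M.sym Scheme.pred Fin.elim0 ![x]

/-- Triangular numbers. -/
def tri (x : M.N) : M.N := M.sym Scheme.tri Fin.elim0 ![x]

/-- The pairing function. -/
def pair (x y : M.N) : M.N := M.sym Scheme.pair Fin.elim0 ![x, y]

/-- The inverse of the triangular numbers, rounded down. -/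
def diag (x : M.N) : M.N := M.sym Scheme.diag Fin.elim0 ![x]

/-- The first projection of the pairing function. -/
def fst (x : M.N) : M.N := M.sym Scheme.fst Fin.elim0 ![x]

/-- The second projection of the pairing function. -/
def snd (x : M.N) : M.N := M.sym Scheme.snd Fin.elim0 ![x]

/-- The code of the string `σ⌢a`, where `c` is the code of `σ`. -/
def cons (c a : M.N) : M.N := pair c a + 1

/-- The code of a string without its last entry. -/
def init (c : M.N) : M.N := fst (pred c)

/-- The last entry of the string with code `c`. -/
def last (c : M.N) : M.N := snd (pred c)

/-- The code of the string with code `c` without its last `j` entries. -/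
def drop (j c : M.N) : M.N := M.sym Scheme.drop Fin.elim0 ![j, c]

/-- The code of the string of the first `l` values of the function `h`. -/
def restrict (h : M.F) (l : M.N) : M.N := M.sym Scheme.restrict ![h] ![l]

section TermFun

/-! The following lemmas allow `simp` to prove that a predicate is given by a quantifier-free
formula. The default bound on the nesting of side conditions is too small for this purpose. -/

variable {f g : M.N × M.N → M.N}

@[simp]
theorem TermFun.sym_one {k : ℕ} (P : Scheme k 1) (fs : Fin k → M.F) (hf : M.TermFun f) :
    M.TermFun fun x => M.sym P fs ![f x] := by
  convert TermFun.sym P fs ![f] (by simpa using hf) using 3 with x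
  funext i; fin_cases i; rfl

@[simp]
theorem TermFun.sym_two {k : ℕ} (P : Scheme k 2) (fs : Fin k → M.F) (hf : M.TermFun f)
    (hg : M.TermFun g) : M.TermFun fun x => M.sym P fs ![f x, g x] := by
  convert TermFun.sym P fs ![f, g] (by simpa [Fin.forall_fin_two] using ⟨hf, hg⟩) using 3 with x
  funext i; fin_cases i <;> rfl

@[simp]
theorem TermFun.add (hf : M.TermFun f) (hg : M.TermFun g) : M.TermFun fun x => f x + g x :=
  .sym_two _ _ hf hg

@[simp]
theorem TermFun.sub (hf : M.TermFun f) (hg : M.TermFun g) : M.TermFun fun x => f x - g x :=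
  .sym_two _ _ hg hf

@[simp]
theorem TermFun.pred (hf : M.TermFun f) : M.TermFun fun x => pred (f x) := .sym_one _ _ hf

@[simp]
theorem TermFun.tri (hf : M.TermFun f) : M.TermFun fun x => tri (f x) := .sym_one _ _ hf

@[simp]
theorem TermFun.diag (hf : M.TermFun f) : M.TermFun fun x => diag (f x) := .sym_one _ _ hf

@[simp]
theorem TermFun.fst (hf : M.TermFun f) : M.TermFun fun x => fst (f x) := .sym_one _ _ hf

@[simp]
theorem TermFun.snd (hf : M.TermFun f) : M.TermFun fun x => snd (f x) := .sym_one _ _ hf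

@[simp]
theorem TermFun.pair (hf : M.TermFun f) (hg : M.TermFun g) :
    M.TermFun fun x => pair (f x) (g x) := .sym_two _ _ hf hg

@[simp]
theorem TermFun.cons (hf : M.TermFun f) (hg : M.TermFun g) :
    M.TermFun fun x => cons (f x) (g x) := .add (.pair hf hg) (.const _)

@[simp]
theorem TermFun.last (hf : M.TermFun f) : M.TermFun fun x => last (f x) := .snd (.pred hf)

@[simp]
theorem TermFun.drop (hf : M.TermFun f) (hg : M.TermFun g) :
    M.TermFun fun x => drop (f x) (g x) := .sym_two _ _ hf hg

@[simp]
theorem TermFun.restrict (h : M.F) (hf : M.TermFun f) :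
    M.TermFun fun x => restrict h (f x) := .sym_one _ _ hf

end TermFun

variable [hM : M.IsPRA]

section Axioms

theorem zero_ne_succ (x : M.N) : M.zero ≠ M.succ x :=
  (realizes_close _).1 (hM.models _ .zero_ne_succ) Fin.elim0 ![x]

theorem succ_inj {x y : M.N} (h : M.succ x = M.succ y) : x = y :=
  (realizes_close _).1 (hM.models _ .succ_inj) Fin.elim0 ![x, y] h

variable {k n : ℕ} (fs : Fin k → M.F)

theorem sym_zero (x : Fin n → M.N) : M.sym .zero fs x = M.zero :=
  (realizes_close _).1 (hM.models _ (.sym_zero k n)) fs x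

theorem sym_succ (x : Fin 1 → M.N) : M.sym .succ fs x = M.succ (x 0) :=
  (realizes_close _).1 (hM.models _ (.sym_succ k)) fs x

theorem sym_proj (i : Fin n) (x : Fin n → M.N) : M.sym (.proj i) fs x = x i :=
  (realizes_close _).1 (hM.models _ (.sym_proj k n i)) fs x

theorem sym_oracle (i : Fin k) (x : Fin 1 → M.N) : M.sym (.oracle i) fs x = (fs i).1 (x 0) :=
  (realizes_close _).1 (hM.models _ (.sym_oracle k i)) fs x

theorem sym_comp {m : ℕ} (P : Scheme k m) (Q : Fin m → Scheme k n) (x : Fin n → M.N) :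
    M.sym (.comp P Q) fs x = M.sym P fs fun j => M.sym (Q j) fs x :=
  (realizes_close _).1 (hM.models _ (.sym_comp k m n P Q)) fs x

theorem sym_comp_one (P : Scheme k 1) (Q : Scheme k n) (x : Fin n → M.N) :
    M.sym (.comp P ![Q]) fs x = M.sym P fs ![M.sym Q fs x] := by
  rw [sym_comp]; congr 1; funext j; fin_cases j; rfl

theorem sym_comp_two (P : Scheme k 2) (Q R : Scheme k n) (x : Fin n → M.N) :
    M.sym (.comp P ![Q, R]) fs x = M.sym P fs ![M.sym Q fs x, M.sym R fs x] := by
  rw [sym_comp]; congr 1; funext j; fin_cases j <;> rfl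

theorem sym_prec_zero (P : Scheme k n) (Q : Scheme k (n + 2)) (x : Fin n → M.N) :
    M.sym (.prec P Q) fs (Matrix.vecCons M.zero x) = M.sym P fs x := by
  have := (realizes_close _).1 (hM.models _ (.sym_prec_zero k n P Q)) fs x
  simp only [Sat, val, id] at this
  rw [← this]
  congr 1; funext i; exact Fin.cases rfl (fun i => rfl) i

theorem sym_prec_succ (P : Scheme k n) (Q : Scheme k (n + 2)) (y : M.N) (x : Fin n → M.N) :
    M.sym (.prec P Q) fs (Matrix.vecCons (M.succ y) x) = M.sym Q fs
      (Matrix.vecCons y (Matrix.vecCons (M.sym (.prec P Q) fs (Matrix.vecCons y x)) x)) := by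
  have := (realizes_close _).1 (hM.models _ (.sym_prec_succ k n P Q)) fs (Matrix.vecCons y x)
  simp only [Sat, val, id] at this
  convert this using 2
  · funext i; exact Fin.cases rfl (fun i => rfl) i
  · funext i; exact Fin.cases rfl (fun i => Fin.cases rfl (fun i => rfl) i) i

end Axioms

theorem sym_add_zero {k : ℕ} (fs : Fin k → M.F) (y : M.N) :
    M.sym Scheme.add fs ![M.zero, y] = y := by
  rw [Scheme.add, sym_prec_zero, sym_proj]; rfl

theorem sym_add_succ {k : ℕ} (fs : Fin k → M.F) (x y : M.N) :
    M.sym Scheme.add fs ![M.succ x, y] = M.succ (M.sym Scheme.add fs ![x, y]) := by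
  rw [Scheme.add, sym_prec_succ, sym_comp_one, sym_succ, sym_proj]; rfl

protected theorem zero_add (y : M.N) : 0 + y = y := sym_add_zero _ y

protected theorem succ_add (x y : M.N) : M.succ x + y = M.succ (x + y) := sym_add_succ _ x y

/-- Induction for predicates that are given by quantifier-free formulas. -/
theorem ind {Q : M.N → Prop} (hQ : M.QFPred fun q => Q q.1) (h0 : Q 0)
    (hs : ∀ x, Q x → Q (M.succ x)) (x : M.N) : Q x :=
  hQ.induction hM.models h0 hs x

protected theorem add_zero (x : M.N) : x + 0 = x := by
  refine ind (Q := fun x => x + 0 = x)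
    (by simp (maxDischargeDepth := 12)) (Model.zero_add _) (fun x h => ?_) x
  rw [Model.succ_add, h]

protected theorem add_succ (x y : M.N) : x + M.succ y = M.succ (x + y) := by
  refine ind (Q := fun x => x + M.succ y = M.succ (x + y)) (by simp (maxDischargeDepth := 12))
    (by simp [Model.zero_add]) (fun x h => ?_) x
  rw [Model.succ_add, h, Model.succ_add]

protected theorem add_comm (x y : M.N) : x + y = y + x := by
  refine ind (Q := fun x => x + y = y + x) (by simp (maxDischargeDepth := 12))
    (by simp [Model.zero_add, Model.add_zero]) (fun x h => ?_) x
  rw [Model.succ_add, h, Model.add_succ]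

protected theorem add_assoc (x y z : M.N) : x + y + z = x + (y + z) := by
  refine ind (Q := fun x => x + y + z = x + (y + z)) (by simp (maxDischargeDepth := 12))
    (by simp [Model.zero_add]) (fun x h => ?_) x
  simp only [Model.succ_add, h]

protected theorem add_left_cancel (x y z : M.N) : x + y = x + z → y = z := by
  refine ind (Q := fun x => x + y = x + z → y = z) (by simp (maxDischargeDepth := 12))
    (by simp [Model.zero_add]) (fun x h h' => h (succ_inj ?_)) x
  rwa [Model.succ_add, Model.succ_add] at h'

instance : AddCancelCommMonoid M.N where
  add_assoc := Model.add_assoc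
  zero_add := Model.zero_add
  add_zero := Model.add_zero
  add_comm := Model.add_comm
  add_left_cancel x y z := Model.add_left_cancel x y z
  nsmul := nsmulRec

theorem succ_eq (x : M.N) : M.succ x = x + 1 := by
  rw [show x + 1 = M.succ (x + 0) from Model.add_succ x _, add_zero]

theorem induct {Q : M.N → Prop} (hQ : M.QFPred fun q => Q q.1) (h0 : Q 0)
    (hs : ∀ x, Q x → Q (x + 1)) (x : M.N) : Q x :=
  ind hQ h0 (fun x => by simpa [succ_eq] using hs x) x

@[simp]
theorem add_one_ne_zero (x : M.N) : x + 1 ≠ 0 := succ_eq x ▸ (zero_ne_succ x).symm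

theorem eq_zero_of_add_eq_zero {x y : M.N} : x + y = 0 → x = 0 := by
  refine induct (Q := fun y => x + y = 0 → x = 0)
    (by simp (maxDischargeDepth := 12)) (by simp) (fun y _ h' => ?_) y
  exact absurd h' (by rw [← add_assoc]; exact add_one_ne_zero _)

@[simp]
theorem pred_zero : pred (0 : M.N) = 0 := by
  rw [pred, Scheme.pred]; exact (sym_prec_zero _ _ _ _).trans (sym_zero _ _)

@[simp]
theorem pred_add_one (x : M.N) : pred (x + 1) = x := by
  rw [pred, Scheme.pred, ← succ_eq, sym_prec_succ, sym_proj]; rfl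

theorem eq_zero_or_eq_add_one (x : M.N) : x = 0 ∨ ∃ y, x = y + 1 := by
  have : x = 0 ∨ x = pred x + 1 :=
    induct (Q := fun x => x = 0 ∨ x = pred x + 1)
      (by simp (maxDischargeDepth := 12)) (.inl rfl) (by simp) x
  exact this.imp_right fun h => ⟨_, h⟩

@[simp]
protected theorem sub_zero (y : M.N) : y - 0 = y := by
  change M.sym Scheme.monus _ ![M.zero, y] = y
  rw [Scheme.monus, sym_prec_zero, sym_proj]; rfl

theorem sub_add_one (y x : M.N) : y - (x + 1) = pred (y - x) := by
  change M.sym Scheme.monus _ ![x + 1, y] = pred (M.sym Scheme.monus _ ![x, y])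
  rw [Scheme.monus, ← succ_eq, sym_prec_succ, sym_comp_one, sym_proj]; rfl

@[simp]
theorem add_one_sub_add_one (y x : M.N) : y + 1 - (x + 1) = y - x := by
  refine induct (Q := fun x => y + 1 - (x + 1) = y - x)
    (by simp (maxDischargeDepth := 12)) ?_ (fun x h => ?_) x
  · rw [sub_add_one, Model.sub_zero, Model.sub_zero, pred_add_one]
  · rw [sub_add_one, h, sub_add_one]

@[simp]
theorem add_sub_self (x y : M.N) : x + y - x = y := by
  refine induct (Q := fun x => x + y - x = y)
    (by simp (maxDischargeDepth := 12)) (by simp) (fun x h => ?_) x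
  rw [add_right_comm, add_one_sub_add_one, h]

@[simp]
protected theorem zero_sub (x : M.N) : 0 - x = 0 := by
  refine induct (Q := fun x => 0 - x = 0)
    (by simp (maxDischargeDepth := 12)) (by simp) (fun x h => ?_) x
  rw [sub_add_one, h, pred_zero]

@[simp]
theorem sub_add_self (x y : M.N) : x - (x + y) = 0 := by
  refine induct (Q := fun x => x - (x + y) = 0)
    (by simp (maxDischargeDepth := 12)) (by simp) (fun x h => ?_) x
  rw [add_right_comm, add_one_sub_add_one, h]

@[simp]
protected theorem sub_self (x : M.N) : x - x = 0 := by simpa using sub_add_self x 0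

theorem exists_add_eq_or (x w : M.N) : (∃ c, x + c = w) ∨ ∃ c, w + c = x := by
  have : x + (w - x) = w ∨ w + (x - w) = x := by
    refine induct (Q := fun x => x + (w - x) = w ∨ w + (x - w) = x)
      (by simp (maxDischargeDepth := 12)) (by simp)
      (fun x h => ?_) x
    rcases h with h | h
    · generalize w - x = c at h
      subst h
      rcases eq_zero_or_eq_add_one c with rfl | ⟨c, rfl⟩
      · right; simp
      · left
        rw [show x + (c + 1) = x + 1 + c by abel, add_sub_self]
    · right
      generalize x - w = c at h
      subst h
      rw [add_assoc, add_sub_self]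
  exact this.imp (fun h => ⟨_, h⟩) fun h => ⟨_, h⟩

theorem exists_add_of_sub_eq_zero {x w : M.N} (h : x - w = 0) : ∃ c, x + c = w := by
  rcases exists_add_eq_or x w with h' | ⟨c, rfl⟩
  · exact h'
  · rw [add_sub_self] at h; exact ⟨0, by simp [h]⟩

/-! ### The pairing function in models of `PRA²` -/

theorem sym_add {k : ℕ} (fs : Fin k → M.F) (x y : M.N) :
    M.sym Scheme.add fs ![x, y] = x + y := by
  refine ind (Q := fun x => M.sym Scheme.add fs ![x, y] = x + y)
    (by simp (maxDischargeDepth := 12)) ?_ (fun x h => ?_) x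
  · rw [zero_add]; exact sym_add_zero _ _
  · rw [sym_add_succ, h, Model.succ_add]

theorem sym_tri_zero {k : ℕ} (fs : Fin k → M.F) : M.sym Scheme.tri fs ![0] = 0 := by
  rw [Scheme.tri]; exact (sym_prec_zero _ _ _ _).trans (sym_zero _ _)

theorem sym_tri_succ {k : ℕ} (fs : Fin k → M.F) (x : M.N) :
    M.sym Scheme.tri fs ![M.succ x] = M.sym Scheme.tri fs ![x] + M.succ x := by
  rw [Scheme.tri, sym_prec_succ, sym_comp_two, sym_comp_one, sym_proj, sym_proj, sym_succ,
    sym_add]; rfl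

@[simp]
theorem tri_zero : tri (0 : M.N) = 0 := sym_tri_zero _

theorem tri_add_one (x : M.N) : tri (x + 1) = tri x + (x + 1) := by
  rw [← succ_eq]; exact sym_tri_succ _ _

theorem sym_tri {k : ℕ} (fs : Fin k → M.F) (x : M.N) : M.sym Scheme.tri fs ![x] = tri x := by
  refine ind (Q := fun x => M.sym Scheme.tri fs ![x] = tri x)
    (by simp (maxDischargeDepth := 12)) ?_ (fun x h => ?_) x
  · rw [sym_tri_zero, tri_zero]
  · rw [sym_tri_succ, h, succ_eq, tri_add_one]

theorem sym_pair' {k : ℕ} (fs : Fin k → M.F) (x y : M.N) :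
    M.sym Scheme.pair fs ![x, y] = tri (x + y) + x := by
  rw [Scheme.pair, sym_comp_two, sym_comp_one, sym_proj, sym_add, sym_add, sym_tri]; rfl

theorem pair_eq (x y : M.N) : pair x y = tri (x + y) + x := sym_pair' _ x y

/-- The pairing function does not depend on the function arguments of its symbol. This matters
because the scheme `restrict` uses the symbol for pairing with one function argument. -/
theorem sym_pair {k : ℕ} (fs : Fin k → M.F) (x y : M.N) :
    M.sym Scheme.pair fs ![x, y] = pair x y := by rw [sym_pair', pair_eq]

@[simp]
theorem diag_zero : diag (0 : M.N) = 0 := by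
  rw [diag, Scheme.diag]; exact (sym_prec_zero _ _ _ _).trans (sym_zero _ _)

theorem diag_add_one (z : M.N) : diag (z + 1) =
    diag z + M.sym Scheme.isZero Fin.elim0 ![tri (diag z + 1) - (z + 1)] := by
  conv_lhs => rw [diag, Scheme.diag, ← succ_eq, sym_prec_succ]
  rw [sym_comp_two, sym_comp_one, sym_comp_two, sym_comp_one, sym_comp_one, sym_comp_one,
    sym_proj, sym_proj, sym_succ, sym_succ, sym_add, sym_tri, ← succ_eq, ← succ_eq]
  rfl

theorem isZero_zero : M.sym Scheme.isZero Fin.elim0 ![0] = 1 := by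
  rw [Scheme.isZero]
  exact (sym_prec_zero _ _ _ _).trans (by rw [sym_comp_one, sym_zero, sym_succ]; rfl)

theorem isZero_add_one (x : M.N) : M.sym Scheme.isZero Fin.elim0 ![x + 1] = 0 := by
  rw [Scheme.isZero, ← succ_eq, sym_prec_succ, sym_zero]; rfl

/-- `diag` is constant between two consecutive triangular numbers. The hypothesis `x - w = 0`
expresses `x ≤ w`. -/
theorem diag_tri_add_of_diag_tri {w : M.N} (hw : diag (tri w) = w) (x : M.N) :
    x - w = 0 → diag (tri w + x) = w := by
  refine induct (Q := fun x => x - w = 0 → diag (tri w + x) = w)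
    (by simp (maxDischargeDepth := 12)) (by simp [hw])
    (fun x ih hx => ?_) x
  obtain ⟨c, rfl⟩ := exists_add_of_sub_eq_zero hx
  have := ih (by rw [add_assoc]; exact sub_add_self _ _)
  rw [← add_assoc, diag_add_one, this, tri_add_one,
    show tri (x + 1 + c) + (x + 1 + c + 1) = (tri (x + 1 + c) + x + 1) + (c + 1) by abel,
    add_sub_self, isZero_add_one, add_zero]

theorem diag_tri (w : M.N) : diag (tri w) = w := by
  refine induct (Q := fun w => diag (tri w) = w)
    (by simp (maxDischargeDepth := 12)) (by simp) (fun w ih => ?_) w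
  rw [tri_add_one, ← add_assoc, diag_add_one, diag_tri_add_of_diag_tri ih w (by simp),
    tri_add_one, ← add_assoc, Model.sub_self, isZero_zero]

theorem diag_pair (x y : M.N) : diag (pair x y) = x + y := by
  rw [pair_eq, diag_tri_add_of_diag_tri (diag_tri _) _ (sub_add_self _ _)]

theorem fst_eq (z : M.N) : fst z = z - tri (diag z) := by
  rw [fst, Scheme.fst, sym_comp_two, sym_comp_one, sym_proj, sym_tri]; rfl

theorem snd_eq (z : M.N) : snd z = diag z - fst z := by
  rw [snd, Scheme.snd, sym_comp_two]; rfl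

@[simp]
theorem fst_pair (x y : M.N) : fst (pair x y) = x := by
  rw [fst_eq, diag_pair, pair_eq, add_sub_self]

@[simp]
theorem snd_pair (x y : M.N) : snd (pair x y) = y := by
  rw [snd_eq, fst_pair, diag_pair, add_sub_self]

@[simp]
theorem pair_zero_zero : pair (0 : M.N) 0 = 0 := by simp [pair_eq]

/-- The pairing function is onto: it enumerates its values along the diagonals. -/
@[simp]
theorem pair_fst_snd (z : M.N) : pair (fst z) (snd z) = z := by
  refine induct (Q := fun z => pair (fst z) (snd z) = z)
    (by simp (maxDischargeDepth := 12)) ?_ (fun z ih => ?_) z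
  · rw [← pair_zero_zero, fst_pair, snd_pair]
  · suffices ∃ a b, z + 1 = pair a b by
      obtain ⟨a, b, h⟩ := this
      rw [h, fst_pair, snd_pair]
    generalize fst z = x at ih
    generalize snd z = y at ih
    subst ih
    rcases eq_zero_or_eq_add_one y with rfl | ⟨y, rfl⟩
    · exact ⟨0, x + 1, by simp only [pair_eq, add_zero, zero_add, tri_add_one]; abel⟩
    · refine ⟨x + 1, y, ?_⟩
      rw [pair_eq, pair_eq, show x + 1 + y = x + (y + 1) by abel]; abel

theorem exists_fst_add_eq (z : M.N) : ∃ t, fst z + t = z :=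
  ⟨tri (fst z + snd z), by conv_rhs => rw [← pair_fst_snd z, pair_eq, add_comm]⟩

/-! ### Codes of strings in models of `PRA²` -/

@[simp]
theorem cons_ne_zero (c a : M.N) : cons c a ≠ 0 := add_one_ne_zero _

@[simp]
theorem init_cons (c a : M.N) : init (cons c a) = c := by simp [init, cons]

@[simp]
theorem init_zero : init (0 : M.N) = 0 := by
  rw [init, pred_zero]; nth_rw 1 [← pair_zero_zero, fst_pair]

theorem cons_init_last {c : M.N} (hc : c ≠ 0) : cons (init c) (last c) = c := by
  obtain ⟨d, rfl⟩ := (eq_zero_or_eq_add_one c).resolve_left hc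
  simp [cons, init, last]

@[simp]
theorem drop_zero (c : M.N) : drop 0 c = c := by
  rw [drop, Scheme.drop]; exact (sym_prec_zero _ _ _ _).trans (sym_proj _ _ _)

theorem drop_succ (j c : M.N) : drop (M.succ j) c = init (drop j c) := by
  conv_lhs => rw [drop, Scheme.drop, sym_prec_succ, sym_comp_one, sym_proj]
  rw [Scheme.init, sym_comp_one]; rfl

theorem drop_add_one (j c : M.N) : drop (j + 1) c = init (drop j c) := by
  rw [← succ_eq, drop_succ]

@[simp]
theorem restrict_zero (h : M.F) : restrict h 0 = 0 := by
  rw [restrict, Scheme.restrict]; exact (sym_prec_zero _ _ _ _).trans (sym_zero _ _)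

theorem restrict_add_one (h : M.F) (l : M.N) :
    restrict h (l + 1) = cons (restrict h l) (h.1 l) := by
  conv_lhs => rw [restrict, Scheme.restrict, ← succ_eq, sym_prec_succ, sym_comp_one,
    sym_comp_two, sym_comp_one, sym_proj, sym_proj, sym_succ, sym_oracle, sym_pair]
  exact succ_eq _

@[simp]
theorem drop_zero_right (j : M.N) : drop j 0 = 0 := by
  refine induct (Q := fun j => drop j 0 = 0)
    (by simp (maxDischargeDepth := 12)) (by simp) (fun j ih => ?_) j
  rw [drop_add_one, ih, init_zero]

theorem drop_add (i j c : M.N) : drop (i + j) c = drop i (drop j c) := by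
  refine induct (Q := fun i => drop (i + j) c = drop i (drop j c))
    (by simp (maxDischargeDepth := 12)) (by simp)
    (fun i ih => ?_) i
  rw [add_right_comm, drop_add_one, ih, drop_add_one]

/-- The length of a string is bounded by its code: the sum of the code and the number of removed
entries does not increase as long as there are entries to remove. -/
theorem drop_self (c : M.N) : drop c c = 0 := by
  have h (j : M.N) : drop j c = 0 ∨ drop j c + j + (c - (drop j c + j)) = c := by
    refine induct (Q := fun j => drop j c = 0 ∨ drop j c + j + (c - (drop j c + j)) = c)
      (by simp (maxDischargeDepth := 12)) (by simp) (fun j ih => ?_) j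
    rw [drop_add_one]
    rcases eq_zero_or_eq_add_one (drop j c) with h | ⟨z, h⟩
    · simp [h]
    right
    obtain ⟨d, hd⟩ : ∃ d, drop j c + j + d = c := by
      rcases ih with h' | h'
      · rw [h] at h'; exact absurd h' (add_one_ne_zero _)
      · exact ⟨_, h'⟩
    obtain ⟨t, ht⟩ := exists_fst_add_eq z
    have : fst z + (j + 1) + (t + d) = c := by
      rw [← hd, h]; conv_rhs => rw [← ht]
      abel
    rw [h, init, pred_add_one]
    conv_lhs => rw [← this, add_sub_self]
    exact this
  rcases h c with h | h
  · exact h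
  · refine eq_zero_of_add_eq_zero (y := c - (drop c c + c)) (add_left_cancel (a := c) ?_)
    rw [add_zero]
    rw [add_left_comm, ← add_assoc, h]

end Model

namespace Model

variable {M : Model}

/-! ### `RCA₀` proves the Baire category theorem -/

theorem val_sym_two (P : Scheme 0 2) {p m : ℕ} (e : Fin p → M.F) (v : Fin m → M.N)
    (s t : Tm p m) :
    M.val e v (.sym P ![] ![s, t]) = M.sym P Fin.elim0 ![M.val e v s, M.val e v t] := by
  rw [val]
  congr 1
  · exact Subsingleton.elim _ _
  · funext i; fin_cases i <;> rfl

theorem realizes_BCT : M.Realizes BCT ↔ ∀ V : M.F,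
    (∀ n σ, ∃ τ k, (∃ j, drop j τ = σ) ∧ ∃ j, drop j τ = V.1 (pair n k)) →
      ∃ h : M.F, ∀ n, ∃ k l, restrict h l = V.1 (pair n k) := by
  have e1 (P : Scheme 1 1) {p m : ℕ} (e : Fin p → M.F) (v : Fin m → M.N) (h : Fin p)
      (t : Tm p m) : M.val e v (.sym P ![h] ![t]) = M.sym P ![e h] ![M.val e v t] := by
    rw [val]
    congr 1
    · funext i; fin_cases i; rfl
    · funext i; fin_cases i; rfl
  have e2 {p m : ℕ} (e : Fin p → M.F) (v : Fin m → M.N) (a : M.N) (t : Tm p m) :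
      M.val e (Fin.cons a v : Fin (m + 1) → M.N) t.liftN = M.val e v t := by
    rw [Tm.liftN, val_subst]; rfl
  have e3 {p m : ℕ} (e : Fin p → M.F) (v : Fin m → M.N) (h : Fin p) (t : Tm p m) :
      M.val e v (.app h t) = (e h).1 (M.val e v t) := rfl
  simp only [Realizes, BCT, Sat, Fml.denseSeq, Fml.memAll, Fml.initSeg, Fml.extendsStr,
    Fml.entry, val_sym_two, e1, e2, e3]
  rfl

/-- A function that is given by a term is in the range of the function variables. -/
theorem TermFun.exists_eq (hM : M.Models RCA0) {f : M.N → M.N} (hf : M.TermFun fun q => f q.1) :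
    ∃ g : M.F, ∀ x, g.1 x = f x := by
  obtain ⟨g, hg⟩ := QFPred.choice hM (Q := fun x y => y = f x) (.eq .right hf)
    fun x => ⟨_, rfl⟩
  exact ⟨g, hg⟩

variable [M.IsPRA]

/-- `IsLen c l`: the string with code `c` has length `l`. -/
def IsLen (c l : M.N) : Prop := drop l c = 0 ∧ (l = 0 ∨ drop (pred l) c ≠ 0)

theorem exists_isLen (c : M.N) : ∃ l, IsLen c l := by
  by_contra! hc
  have h (l : M.N) : drop l c ≠ 0 := by
    refine induct (Q := fun l => drop l c ≠ 0) (by simp (maxDischargeDepth := 12))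
      (fun h => hc 0 ⟨h, .inl rfl⟩) (fun l ih h => hc (l + 1) ⟨h, .inr ?_⟩) l
    rwa [pred_add_one]
  exact h c (drop_self c)

theorem drop_eq_zero_of_isLen {c l : M.N} (h : IsLen c l) (i : M.N) : drop (i + l) c = 0 := by
  rw [drop_add, h.1, drop_zero_right]

theorem IsLen.unique {c l l' : M.N} (h : IsLen c l) (h' : IsLen c l') : l = l' := by
  have key {l l' d : M.N} (h : IsLen c l) (h' : IsLen c l') (hd : l + d = l') : l = l' := by
    rcases eq_zero_or_eq_add_one d with rfl | ⟨d, rfl⟩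
    · simpa using hd
    · subst hd
      rcases h'.2 with h₀ | h₀
      · exact absurd h₀ (by rw [← add_assoc]; exact add_one_ne_zero _)
      · rw [← add_assoc, pred_add_one, add_comm, drop_eq_zero_of_isLen h] at h₀
        exact absurd rfl h₀
  rcases exists_add_eq_or l l' with ⟨d, hd⟩ | ⟨d, hd⟩
  · exact key h h' hd
  · exact (key h' h hd).symm

theorem isLen_zero : IsLen (0 : M.N) 0 := ⟨drop_zero_right 0, .inl rfl⟩

theorem IsLen.drop {c l j : M.N} (h : IsLen c (j + l)) : IsLen (drop j c) l := by
  refine ⟨by rw [← drop_add, add_comm, h.1], ?_⟩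
  rcases eq_zero_or_eq_add_one l with rfl | ⟨l, rfl⟩
  · exact .inl rfl
  · right
    have := h.2.resolve_left (by rw [← add_assoc]; exact add_one_ne_zero _)
    rwa [← add_assoc, pred_add_one, add_comm, drop_add, ← pred_add_one l] at this

theorem IsLen.ne_zero {c l : M.N} (h : IsLen c (l + 1)) : c ≠ 0 := by
  rintro rfl
  exact add_one_ne_zero l (h.unique isLen_zero)

/-- The initial segments of the strings `h(0) ⋯ h(l-1)` are again strings of this form. -/
theorem exists_restrict_eq_drop (h : M.F) (l j : M.N) :
    ∃ l', restrict h l' = drop j (restrict h l) := by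
  have : restrict h (l - j) = drop j (restrict h l) := by
    refine induct (Q := fun j => restrict h (l - j) = drop j (restrict h l))
      (by simp (maxDischargeDepth := 12)) (by simp) (fun j ih => ?_) j
    rw [drop_add_one, ← ih, sub_add_one]
    rcases eq_zero_or_eq_add_one (l - j) with h0 | ⟨i, hi⟩
    · simp [h0]
    · rw [hi, pred_add_one, restrict_add_one, init_cons]
  exact ⟨_, this⟩

/-- The recursion `s(0) = 0`, `s(n + 1) = g(⟨n, s(n)⟩)`. -/
theorem exists_rec (hM : M.Models RCA0) (g : M.F) :
    ∃ s : M.F, s.1 0 = 0 ∧ ∀ n, s.1 (n + 1) = g.1 (pair n (s.1 n)) := by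
  let P : Scheme 1 1 := .prec .zero (.comp (.oracle 0) ![.comp .pair ![.proj 0, .proj 1]])
  obtain ⟨s, hs⟩ := TermFun.exists_eq hM (f := fun x => M.sym P ![g] ![x]) (by simp)
  refine ⟨s, ?_, fun n => ?_⟩
  · rw [hs]
    exact (sym_prec_zero _ _ _ _).trans (sym_zero _ _)
  · rw [hs, hs, ← succ_eq, sym_prec_succ, sym_comp_one, sym_comp_two, sym_oracle, sym_proj,
      sym_proj, sym_pair]
    rfl

/-- A sequence of strings, each properly extended by the next, has a limit function. Its value at
`x` is the entry of the string `s (x + 1)` at the position `x`. As removing entries from the empty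
string does nothing, the hypothesis has to say that the extension `s (n + 1)` is not empty. -/
theorem exists_limit (hM : M.Models RCA0) (s : M.F) (h0 : s.1 0 = 0)
    (hs : ∀ n, ∃ j, drop (j + 1) (s.1 (n + 1)) = s.1 n ∧ s.1 (n + 1) ≠ 0) :
    ∃ h : M.F, ∀ n, ∃ l, restrict h l = s.1 n := by
  obtain ⟨L, hL⟩ := QFPred.choice hM (Q := IsLen)
    (by unfold IsLen; simp (maxDischargeDepth := 12)) exists_isLen
  have hstep (n : M.N) : ∃ i, L.1 (s.1 (n + 1)) = L.1 (s.1 n) + (i + 1) ∧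
      drop (i + 1) (s.1 (n + 1)) = s.1 n := by
    obtain ⟨j, hj, hne⟩ := hs n
    have hl := hL (s.1 (n + 1))
    rcases exists_add_eq_or (j + 1) (L.1 (s.1 (n + 1))) with ⟨d, hd⟩ | ⟨d, hd⟩
    · refine ⟨j, ?_, hj⟩
      rw [← hd] at hl
      rw [← hd, (hL (s.1 n)).unique (hj ▸ hl.drop), add_comm]
    -- Here more entries than there are were removed, so `s n` is the empty string.
    · have h0 : s.1 n = 0 := by rw [← hj, ← hd, add_comm, drop_eq_zero_of_isLen hl]
      rcases eq_zero_or_eq_add_one (L.1 (s.1 (n + 1))) with h | ⟨i, hi⟩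
      · exact absurd (by simpa [h] using hl.1) hne
      · refine ⟨i, ?_, ?_⟩
        · rw [h0, (hL 0).unique isLen_zero, zero_add, hi]
        · rw [h0, ← hi, hl.1]
  have hlen (n : M.N) : ∃ d, n + d = L.1 (s.1 n) := by
    refine exists_add_of_sub_eq_zero (induct (Q := fun n => n - L.1 (s.1 n) = 0)
      (by simp (maxDischargeDepth := 12)) (by simp) (fun n ih => ?_) n)
    obtain ⟨d, hd⟩ := exists_add_of_sub_eq_zero ih
    obtain ⟨i, hi, -⟩ := hstep n
    rw [hi, ← hd, show n + d + (i + 1) = n + 1 + (d + i) by abel, sub_add_self]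
  -- The initial segment of length `l` is the same for all strings of length at least `l`.
  have hpre {l n : M.N} (h : ∃ d, l + d = L.1 (s.1 n)) :
      (∃ d, l + d = L.1 (s.1 (n + 1))) ∧ drop (L.1 (s.1 (n + 1)) - l) (s.1 (n + 1)) =
        drop (L.1 (s.1 n) - l) (s.1 n) := by
    obtain ⟨d, hd⟩ := h
    obtain ⟨i, hi, hi'⟩ := hstep n
    rw [← hd, add_assoc] at hi
    exact ⟨⟨_, hi.symm⟩, by rw [hi, add_sub_self, drop_add, hi', ← hd, add_sub_self]⟩
  have hpre' {l n : M.N} (h : ∃ d, l + d = L.1 (s.1 n)) (i : M.N) :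
      l - L.1 (s.1 (n + i)) = 0 ∧ drop (L.1 (s.1 (n + i)) - l) (s.1 (n + i)) =
        drop (L.1 (s.1 n) - l) (s.1 n) := by
    refine induct (Q := fun i => l - L.1 (s.1 (n + i)) = 0 ∧
        drop (L.1 (s.1 (n + i)) - l) (s.1 (n + i)) = drop (L.1 (s.1 n) - l) (s.1 n))
      (by simp (maxDischargeDepth := 12)) ?_ (fun i ih => ?_) i
    · obtain ⟨d, hd⟩ := h
      simp [← hd]
    · obtain ⟨⟨d, hd⟩, h'⟩ := hpre (exists_add_of_sub_eq_zero ih.1)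
      rw [← add_assoc]
      exact ⟨by rw [← hd, sub_add_self], h'.trans ih.2⟩
  obtain ⟨h, hh⟩ := TermFun.exists_eq hM
    (f := fun x => last (drop (L.1 (s.1 (x + 1)) - (x + 1)) (s.1 (x + 1))))
    (by simp (maxDischargeDepth := 12))
  have hr (l : M.N) : restrict h l = drop (L.1 (s.1 l) - l) (s.1 l) := by
    refine induct (Q := fun l => restrict h l = drop (L.1 (s.1 l) - l) (s.1 l))
      (by simp (maxDischargeDepth := 12)) (by simp [h0]) (fun l ih => ?_) l
    rw [restrict_add_one, ih, hh, ← (hpre (hlen l)).2]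
    obtain ⟨d, hd⟩ := hlen (l + 1)
    have hl := hL (s.1 (l + 1))
    rw [← hd, add_comm _ d] at hl
    rw [← hd, add_sub_self, add_assoc, add_sub_self, add_comm 1 d, drop_add_one]
    exact cons_init_last hl.drop.ne_zero
  refine ⟨h, fun n => ⟨L.1 (s.1 n), ?_⟩⟩
  obtain ⟨d, hd⟩ := hlen n
  have := (hpre' (n := n) ⟨0, add_zero _⟩ d).2
  rw [hd] at this
  rw [hr, this, Model.sub_self, drop_zero]

theorem realizes_BCT_of_models_RCA0 (hM : M.Models RCA0) : M.Realizes BCT := by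
  refine realizes_BCT.2 fun V hV => ?_
  -- A number `w` codes the extension `τ = ⟨w⟩₀` and the witnesses of its properties.
  obtain ⟨W, hW⟩ := QFPred.choice hM (Q := fun x w =>
      drop (fst (snd (snd w))) (fst w) = snd x ∧
      drop (snd (snd (snd w))) (fst w) = V.1 (pair (fst x) (fst (snd w))))
    (by simp (maxDischargeDepth := 12)) fun x => by
      obtain ⟨τ, k, ⟨i, hi⟩, j, hj⟩ := hV (fst x) (snd x)
      exact ⟨pair τ (pair k (pair i j)), by simp [hi, hj]⟩
  obtain ⟨g, hg⟩ := TermFun.exists_eq hM (f := fun x => cons (fst (W.1 x)) 0)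
    (by simp (maxDischargeDepth := 12))
  obtain ⟨s, hs0, hs⟩ := exists_rec hM g
  have e (j c a : M.N) : drop (j + 1) (cons c a) = drop j c := by
    rw [drop_add, ← zero_add (1 : M.N), drop_add_one, drop_zero, init_cons]
  obtain ⟨h, hh⟩ := exists_limit hM s hs0 fun n => by
    refine ⟨fst (snd (snd (W.1 (pair n (s.1 n))))), ?_, by rw [hs, hg]; exact cons_ne_zero _ _⟩
    rw [hs, hg, e, (hW _).1, snd_pair]
  refine ⟨h, fun n => ?_⟩
  obtain ⟨l, hl⟩ := hh (n + 1)
  obtain ⟨l', hl'⟩ := exists_restrict_eq_drop h l (snd (snd (snd (W.1 (pair n (s.1 n))))) + 1)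
  refine ⟨fst (snd (W.1 (pair n (s.1 n)))), l', ?_⟩
  rw [hl', hl, hs, hg, e, (hW _).2, fst_pair]

end Model

/-! ### Primitive recursive functions -/

namespace Scheme

theorem eval_prec_zero {k n : ℕ} (fs : Fin k → ℕ → ℕ) (P : Scheme k n) (Q : Scheme k (n + 2))
    (x : Fin n → ℕ) : (prec P Q).eval fs (Fin.cons 0 x) = P.eval fs x := by
  simp [eval]

theorem eval_prec_succ {k n : ℕ} (fs : Fin k → ℕ → ℕ) (P : Scheme k n) (Q : Scheme k (n + 2))
    (y : ℕ) (x : Fin n → ℕ) : (prec P Q).eval fs (Fin.cons (y + 1) x) =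
      Q.eval fs (Fin.cons y (Fin.cons ((prec P Q).eval fs (Fin.cons y x)) x)) := by
  simp [eval]

theorem exists_of_primrec' {k n : ℕ} {f : List.Vector ℕ n → ℕ} (hf : Nat.Primrec' f) :
    ∃ P : Scheme k n, ∀ fs v, P.eval fs v.get = f v := by
  induction hf with
  | zero => exact ⟨zero, fun _ _ => rfl⟩
  | succ => exact ⟨succ, fun _ v => by simp [eval]⟩
  | get i => exact ⟨proj i, fun _ _ => rfl⟩
  | comp g _ _ ihf ihg =>
    obtain ⟨P, hP⟩ := ihf
    choose Q hQ using ihg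
    refine ⟨comp P Q, fun fs v => ?_⟩
    simp only [eval, hQ, ← hP fs]
    congr 1
    funext i
    simp
  | @prec n f g _ _ ihf ihg =>
    obtain ⟨P, hP⟩ := ihf
    obtain ⟨Q, hQ⟩ := ihg
    refine ⟨prec P Q, fun fs v => ?_⟩
    obtain ⟨x, v, rfl⟩ := v.exists_eq_cons
    have e {m : ℕ} (a : ℕ) (w : List.Vector ℕ m) :
        (a ::ᵥ w).get = (Fin.cons a w.get : Fin (m + 1) → ℕ) := by
      funext i; refine Fin.cases ?_ (fun i => ?_) i <;> simp
    rw [e]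
    simp only [List.Vector.head_cons, List.Vector.tail_cons]
    induction x with
    | zero => rw [eval_prec_zero]; exact hP fs v
    | succ x ih => rw [eval_prec_succ, ih, ← e, ← e, hQ]

theorem primrec'_eval {n : ℕ} (fs : Fin 0 → ℕ → ℕ) (P : Scheme 0 n) :
    Nat.Primrec' fun v : List.Vector ℕ n => P.eval fs v.get := by
  induction P with
  | zero => exact Nat.Primrec'.const 0
  | succ => exact Nat.Primrec'.succ.of_eq fun v => by simp [eval]
  | proj i => exact .get i
  | oracle i => exact i.elim0
  | comp P Q ihP ihQ =>
    refine (Nat.Primrec'.comp _ ihP ihQ).of_eq fun v => ?_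
    rw [eval]; congr 1; funext i; simp
  | prec P Q ihP ihQ =>
    refine (Nat.Primrec'.prec ihP ihQ).of_eq fun v => ?_
    have e {m : ℕ} (a : ℕ) (w : List.Vector ℕ m) :
        (a ::ᵥ w).get = (Fin.cons a w.get : Fin (m + 1) → ℕ) := by
      funext i; refine Fin.cases ?_ (fun i => ?_) i <;> simp
    obtain ⟨x, v, rfl⟩ := v.exists_eq_cons
    rw [e]
    simp only [List.Vector.head_cons, List.Vector.tail_cons]
    induction x with
    | zero => exact (eval_prec_zero _ _ _ _).symm
    | succ x ih => simp only [eval_prec_succ, ← ih, e]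

theorem exists_of_primrec (k : ℕ) {f : ℕ → ℕ} (hf : Primrec f) :
    ∃ P : Scheme k 1, ∀ fs x, P.eval fs ![x] = f x := by
  obtain ⟨P, hP⟩ := exists_of_primrec' (k := k) (Nat.Primrec'.prim_iff₁.2 hf)
  refine ⟨P, fun fs x => ?_⟩
  rw [← List.Vector.head_cons x .nil, ← hP fs]
  congr 1
  funext i; fin_cases i; rfl

theorem exists_of_primrec₂ (k : ℕ) {f : ℕ → ℕ → ℕ} (hf : Primrec₂ f) :
    ∃ P : Scheme k 2, ∀ fs x y, P.eval fs ![x, y] = f x y := by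
  obtain ⟨P, hP⟩ := exists_of_primrec' (k := k) (Nat.Primrec'.prim_iff₂.2 hf)
  refine ⟨P, fun fs x y => ?_⟩
  refine Eq.trans ?_ (hP fs (x ::ᵥ y ::ᵥ .nil))
  congr 1
  funext i; fin_cases i <;> rfl

theorem primrec_eval (fs : Fin 0 → ℕ → ℕ) (P : Scheme 0 1) : Primrec fun x => P.eval fs ![x] := by
  refine (Nat.Primrec'.prim_iff.1 (primrec'_eval fs P)).comp
    (Primrec.vector_cons.comp .id (.const .nil)) |>.of_eq fun x => ?_
  congr 1
  funext i; fin_cases i; rfl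

theorem primrec₂_eval (fs : Fin 0 → ℕ → ℕ) (P : Scheme 0 2) :
    Primrec₂ fun x y => P.eval fs ![x, y] := by
  refine (Nat.Primrec'.prim_iff.1 (primrec'_eval fs P)).comp
    (Primrec.vector_cons.comp .fst (Primrec.vector_cons.comp .snd (.const .nil))) |>.of_eq
      fun x => ?_
  congr 1
  funext i; fin_cases i <;> rfl

end Scheme

/-- Every primitive recursive function is dominated by the diagonal of the Ackermann function. -/
theorem exists_forall_lt_ack_self {h : ℕ → ℕ} (hh : Primrec h) :
    ∃ N, ∀ n ≥ N, h n < ack n n := by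
  obtain ⟨m, hm⟩ := exists_lt_ack_of_nat_primrec (Primrec.nat_iff.1 hh)
  exact ⟨m, fun n hn => (hm n).trans_le (ack_mono_left n hn)⟩

/-- A number `m` with `R(j, m)` codes a halting computation of the diagonal of the Ackermann
function at `j`. In contrast to the function, the relation `R` is primitive recursive. -/
theorem exists_primrecRel_ack_le : ∃ R : ℕ → ℕ → Prop, PrimrecRel R ∧ (∀ j, ∃ m, R j m) ∧
    ∀ j m, R j m → ack j j ≤ m := by
  have hc : Computable fun n => ack n n := computable₂_ack.comp .id .id
  obtain ⟨c, hc⟩ := Nat.Partrec.Code.exists_code.1 (Partrec.nat_iff.1 hc)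
  refine ⟨fun j m => Nat.Partrec.Code.evaln m.unpair.1 c j = some m.unpair.2, ?_,
    fun j => ?_, fun j m h => ?_⟩
  · refine Primrec.eq.comp (Nat.Partrec.Code.primrec_evaln.comp (.pair (.pair ?_ (.const c)) .fst))
      (Primrec.option_some.comp ?_)
    · exact Primrec.fst.comp (Primrec.unpair.comp .snd)
    · exact Primrec.snd.comp (Primrec.unpair.comp .snd)
  · have : ack j j ∈ c.eval j := by rw [hc]; exact Part.mem_some _
    obtain ⟨s, hs⟩ := Nat.Partrec.Code.evaln_complete.1 this
    exact ⟨Nat.pair s (ack j j), by simpa using hs⟩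
  · have := Nat.Partrec.Code.evaln_sound h
    rw [hc] at this
    rw [← (Part.mem_some_iff.1 this : _ = ack j j)]
    exact Nat.unpair_right_le m

/-! ### A sequence of dense open sets without primitive recursive points in the intersection -/

theorem mem_basicOpen {σ : List ℕ} {h : ℕ → ℕ} :
    h ∈ basicOpen σ ↔ (List.range σ.length).map h = σ := by
  rw [basicOpen, Set.mem_ofPred_eq, List.ofFn_eq_map, ← List.map_coe_finRange_eq_range,
    List.map_map]
  rfl

theorem mem_basicOpen_iff {σ : List ℕ} {h : ℕ → ℕ} :
    h ∈ basicOpen σ ↔ ∀ i (hi : i < σ.length), h i = σ[i] := by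
  rw [mem_basicOpen]
  constructor
  · intro e i hi
    simp [← List.getElem_of_eq e (by simpa using hi)]
  · exact fun e => List.ext_getElem (by simp) fun i _ hi => by simp [e i hi]

theorem basicOpen_map_range (h : ℕ → ℕ) (n : ℕ) :
    basicOpen ((List.range n).map h) = PiNat.cylinder h n := by
  ext g
  simp [mem_basicOpen_iff, PiNat.mem_cylinder_iff]

theorem basicOpen_eq_cylinder {σ : List ℕ} {h : ℕ → ℕ} (hh : h ∈ basicOpen σ) :
    basicOpen σ = PiNat.cylinder h σ.length := by
  rw [← basicOpen_map_range, mem_basicOpen.1 hh]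

theorem isOpen_openSet (W : ℕ → List ℕ) : IsOpen (openSet W) := by
  refine isOpen_iUnion fun k => isOpen_iff_mem_nhds.2 fun h hh => ?_
  rw [basicOpen_eq_cylinder hh]
  exact (PiNat.isOpen_cylinder _ h _).mem_nhds (PiNat.self_mem_cylinder h _)

theorem dense_iff_cylinder {S : Set (ℕ → ℕ)} :
    Dense S ↔ ∀ (h : ℕ → ℕ) n, (PiNat.cylinder h n ∩ S).Nonempty := by
  rw [(PiNat.isTopologicalBasis_cylinders fun _ => ℕ).dense_iff]
  exact ⟨fun H h n => H _ ⟨h, n, rfl⟩ ⟨h, PiNat.self_mem_cylinder h n⟩,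
    fun H o ⟨h, n, e⟩ _ => e ▸ H h n⟩

/-- The string that consists of `σ`, `N` zeros and `s`, if `R` relates the position of `s` to `s`.
If it does not, the default string of `N` zeros and `t` is used. In order that the default is in
the same open set, `t` has to be a witness for the position `N`; without such a witness the open
set is the whole space. -/
def diagString (R : ℕ → ℕ → Prop) [DecidableRel R] (N t : ℕ) (σ : List ℕ) (s : ℕ) : List ℕ :=
  if R (σ ++ List.replicate N 0).length s then σ ++ List.replicate N 0 ++ [s]
  else if R N t then List.replicate N 0 ++ [t] else []

/-- The strings `diagString`, for `n = ⟨N, t⟩` and `k = ⟨σ, s⟩`. -/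
def diagSeq (R : ℕ → ℕ → Prop) [DecidableRel R] (n k : ℕ) : List ℕ :=
  diagString R n.unpair.1 n.unpair.2 (Denumerable.ofNat (List ℕ) k.unpair.1) k.unpair.2

variable {R : ℕ → ℕ → Prop} [DecidableRel R]

theorem primrec₂_diagSeq (hR : PrimrecRel R) : Primrec₂ (diagSeq R) := by
  have hN : Primrec fun q : ℕ × ℕ => q.1.unpair.1 := .comp .fst (.comp .unpair .fst)
  have ht : Primrec fun q : ℕ × ℕ => q.1.unpair.2 := .comp .snd (.comp .unpair .fst)
  have hs : Primrec fun q : ℕ × ℕ => q.2.unpair.2 := .comp .snd (.comp .unpair .snd)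
  have hz : Primrec fun q : ℕ × ℕ => List.replicate q.1.unpair.1 0 :=
    (Primrec.list_map (Primrec.list_range.comp hN) (Primrec.const 0).to₂).of_eq fun q => by simp
  have hσ : Primrec fun q : ℕ × ℕ => Denumerable.ofNat (List ℕ) q.2.unpair.1 ++
      List.replicate q.1.unpair.1 0 :=
    Primrec.list_append.comp
      ((Primrec.ofNat _).comp (Primrec.fst.comp (Primrec.unpair.comp .snd))) hz
  exact Primrec.ite (hR.comp (Primrec.list_length.comp hσ) hs) (Primrec.list_concat.comp hσ hs)
    (Primrec.ite (hR.comp hN ht) (Primrec.list_concat.comp hz ht) (Primrec.const []))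

theorem dense_openSet_diagSeq (hR : ∀ j, ∃ m, R j m) (n : ℕ) : Dense (openSet (diagSeq R n)) := by
  refine dense_iff_cylinder.2 fun h l => ?_
  obtain ⟨s, hs⟩ := hR ((List.range l).map h ++ List.replicate n.unpair.1 0).length
  set σ := (List.range l).map h ++ List.replicate n.unpair.1 0 with hσ
  refine ⟨fun i => (σ ++ [s]).getD i 0, ?_, Set.mem_iUnion.2
    ⟨Nat.pair (Encodable.encode ((List.range l).map h)) s, ?_⟩⟩
  · rw [PiNat.mem_cylinder_iff]
    intro i hi
    simp [hσ, List.getElem?_append, hi]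
  · rw [diagSeq, Nat.unpair_pair, Denumerable.ofNat_encode, diagString, if_pos hs,
      mem_basicOpen_iff]
    exact fun i hi => List.getD_eq_getElem _ _ hi

theorem exists_of_mem_openSet_diagSeq (hR : ∀ j, ∃ m, R j m) {h : ℕ → ℕ}
    (hh : ∀ n, h ∈ openSet (diagSeq R n)) (N : ℕ) : ∃ j ≥ N, R j (h j) := by
  obtain ⟨t, ht⟩ := hR N
  obtain ⟨k, hk⟩ := Set.mem_iUnion.1 (hh (Nat.pair N t))
  have key {σ : List ℕ} {a : ℕ} (hσ : h ∈ basicOpen (σ ++ [a])) : h σ.length = a := by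
    simpa using mem_basicOpen_iff.1 hσ σ.length (by simp)
  rw [diagSeq, Nat.unpair_pair, diagString, if_pos ht] at hk
  split_ifs at hk with h1
  · exact ⟨_, by simp, (key hk).symm ▸ h1⟩
  · refine ⟨N, le_rfl, ?_⟩
    have := key hk
    rw [List.length_replicate] at this
    rwa [this]

theorem not_primrec_of_mem_openSet_diagSeq (hR : ∀ j, ∃ m, R j m)
    (hRack : ∀ j m, R j m → ack j j ≤ m) {h : ℕ → ℕ} (hh : ∀ n, h ∈ openSet (diagSeq R n)) :
    ¬ Primrec h := by
  intro hp
  obtain ⟨N, hN⟩ := exists_forall_lt_ack_self hp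
  obtain ⟨j, hj, hR⟩ := exists_of_mem_openSet_diagSeq hR hh N
  exact (hN j hj).not_ge (hRack j _ hR)

/-! ### `ω`-models -/

namespace Scheme

theorem exists_eval_eq_const (k n c : ℕ) : ∃ P : Scheme k n, ∀ fs x, P.eval fs x = c := by
  induction c with
  | zero => exact ⟨zero, fun _ _ => rfl⟩
  | succ c ih =>
    obtain ⟨P, hP⟩ := ih
    exact ⟨comp succ fun _ => P, fun fs x => by simp [eval, hP]⟩

/-- Substitution of schemes for the function arguments of a scheme. -/
def substOracle {k k' : ℕ} (R : Fin k → Scheme k' 1) : {n : ℕ} → Scheme k n → Scheme k' n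
  | _, zero => zero
  | _, succ => succ
  | _, proj i => proj i
  | _, oracle i => R i
  | _, comp P Q => comp (P.substOracle R) fun j => (Q j).substOracle R
  | _, prec P Q => prec (P.substOracle R) (Q.substOracle R)

theorem eval_substOracle {k k' n : ℕ} (R : Fin k → Scheme k' 1) (P : Scheme k n)
    (fs : Fin k' → ℕ → ℕ) (x : Fin n → ℕ) :
    (P.substOracle R).eval fs x = P.eval (fun i y => (R i).eval fs ![y]) x := by
  induction P with
  | zero => rfl
  | succ => rfl
  | proj i => rfl
  | oracle i =>
    simp only [substOracle, eval]
    congr 1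
    funext i; fin_cases i; rfl
  | comp P Q ihP ihQ => simp only [substOracle, eval, ihP, ihQ]
  | prec P Q ihP ihQ => simp only [substOracle, eval, ihP, ihQ]

end Scheme

/-- The set `K` is closed under primitive recursive functionals. -/
def IsPRClosed (K : Set (ℕ → ℕ)) : Prop :=
  ∀ (k : ℕ) (P : Scheme k 1) (fs : Fin k → ℕ → ℕ), (∀ i, fs i ∈ K) →
    (fun y => P.eval fs ![y]) ∈ K

theorem IsPRClosed.eval_cons_mem {K : Set (ℕ → ℕ)} (hK : IsPRClosed K) {k n : ℕ}
    (P : Scheme k (n + 1)) {fs : Fin k → ℕ → ℕ} (hfs : ∀ i, fs i ∈ K) (a : Fin n → ℕ) :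
    (fun y => P.eval fs (Fin.cons y a)) ∈ K := by
  choose C hC using fun i => Scheme.exists_eval_eq_const k 1 (a i)
  convert hK k (.comp P (Fin.cons (.proj 0) C)) fs hfs using 2 with y
  rw [Scheme.eval]
  congr 1
  funext i
  exact Fin.cases rfl (fun i => (hC i fs ![y]).symm) i

theorem val_sym_omega {K : Set (ℕ → ℕ)} {p m k n : ℕ} (e : Fin p → (omega K).F)
    (v : Fin m → (omega K).N) (P : Scheme k n) (fs : Fin k → Fin p) (ts : Fin n → Tm p m) :
    (omega K).val e v (.sym P fs ts) =
      P.eval (fun i => (e (fs i)).1) (fun i => (omega K).val e v (ts i)) := rfl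

theorem IsPRClosed.models_PRA2 {K : Set (ℕ → ℕ)} (hK : IsPRClosed K) :
    (omega K).Models PRA2 := by
  intro φ hφ
  cases hφ with
  | functional k n P =>
    refine (Model.realizes_close _).2 fun e v => ?_
    exact ⟨⟨_, hK.eval_cons_mem P (fun i => (e i).2) v⟩, fun x => rfl⟩
  | induction p m θ hθ =>
    refine (Model.realizes_close _).2 fun e v => ?_
    simp only [Model.Sat, Model.sat_subst_of_isQF _ _ _ _ θ hθ]
    rintro ⟨h0, hs⟩ x
    induction (x : ℕ) with
    | zero =>
      refine cast (congrArg (fun w => (omega K).Sat e w θ) ?_) h0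
      funext i; exact Fin.cases rfl (fun i => rfl) i
    | succ x ih =>
      refine cast (congrArg (fun w => (omega K).Sat e w θ) ?_) (hs x ih)
      funext i; exact Fin.cases rfl (fun i => rfl) i
  | zero_ne_succ => exact (Model.realizes_close _).2 fun e v => (Nat.succ_ne_zero _).symm
  | succ_inj => exact (Model.realizes_close _).2 fun e v => Nat.succ_inj.1
  | not_lt_zero => exact (Model.realizes_close _).2 fun e v => Nat.not_lt_zero _
  | lt_succ =>
    exact (Model.realizes_close _).2 fun e v =>
      ⟨Nat.lt_succ_iff_lt_or_eq.1, Nat.lt_succ_iff_lt_or_eq.2⟩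
  | sym_zero => exact (Model.realizes_close _).2 fun e v => rfl
  | sym_succ => exact (Model.realizes_close _).2 fun e v => rfl
  | sym_proj => exact (Model.realizes_close _).2 fun e v => rfl
  | sym_oracle => exact (Model.realizes_close _).2 fun e v => rfl
  | sym_comp => exact (Model.realizes_close _).2 fun e v => rfl
  | sym_prec_zero k n P Q =>
    refine (Model.realizes_close _).2 fun e v => ?_
    rw [Model.Sat, val_sym_omega, val_sym_omega]
    refine Eq.trans (congrArg (Scheme.eval _ (.prec P Q)) ?_) (Scheme.eval_prec_zero _ P Q v)
    funext i; exact Fin.cases rfl (fun i => rfl) i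
  | sym_prec_succ k n P Q =>
    refine (Model.realizes_close _).2 fun e v => ?_
    rw [Model.Sat, val_sym_omega, val_sym_omega]
    refine Eq.trans (congrArg (Scheme.eval _ (.prec P Q)) ?_)
      ((Scheme.eval_prec_succ _ P Q (v 0) (Fin.tail v)).trans (congrArg (Scheme.eval _ Q) ?_))
    · funext i; exact Fin.cases rfl (fun i => rfl) i
    · funext i
      refine Fin.cases rfl (fun i => Fin.cases ?_ (fun i => rfl) i) i
      exact congrArg (Scheme.eval _ _) (Fin.cons_self_tail v)

/-- The functions that are primitive recursive in the functions `hs`. -/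
def primrecIn {s : ℕ} (hs : Fin s → ℕ → ℕ) : Set (ℕ → ℕ) :=
  {g | ∃ P : Scheme s 1, g = fun y => P.eval hs ![y]}

theorem isPRClosed_primrecIn {s : ℕ} (hs : Fin s → ℕ → ℕ) : IsPRClosed (primrecIn hs) := by
  intro k P fs hfs
  choose Q hQ using hfs
  refine ⟨P.substOracle Q, ?_⟩
  obtain rfl : fs = fun i y => (Q i).eval hs ![y] := funext hQ
  simp only [Scheme.eval_substOracle]

theorem mem_primrecIn {s : ℕ} (hs : Fin s → ℕ → ℕ) (i : Fin s) : hs i ∈ primrecIn hs :=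
  ⟨.oracle i, rfl⟩

theorem mem_primrecIn_of_primrec {s : ℕ} (hs : Fin s → ℕ → ℕ) {f : ℕ → ℕ} (hf : Primrec f) :
    f ∈ primrecIn hs := by
  obtain ⟨P, hP⟩ := Scheme.exists_of_primrec s hf
  exact ⟨P, funext fun y => (hP hs y).symm⟩

theorem primrec_of_mem_primrecIn {hs : Fin 0 → ℕ → ℕ} {f : ℕ → ℕ} (hf : f ∈ primrecIn hs) :
    Primrec f := by
  obtain ⟨P, rfl⟩ := hf
  exact P.primrec_eval hs

theorem primrecIn_mono (h : ℕ → ℕ → ℕ) :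
    Monotone fun s => primrecIn fun i : Fin s => h i := by
  rintro s s' hs _ ⟨P, rfl⟩
  exact isPRClosed_primrecIn _ s P _ fun i => mem_primrecIn (fun i : Fin s' => h i) (i.castLE hs)

theorem isPRClosed_iUnion_primrecIn (h : ℕ → ℕ → ℕ) :
    IsPRClosed (⋃ s, primrecIn fun i : Fin s => h i) := by
  intro k P fs hfs
  choose s hs using fun i => Set.mem_iUnion.1 (hfs i)
  refine Set.mem_iUnion.2 ⟨Finset.univ.sup s, isPRClosed_primrecIn _ k P fs fun i => ?_⟩
  exact primrecIn_mono h (Finset.le_sup (Finset.mem_univ i)) (hs i)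

/-! ### Codes of strings in the standard model

The facts about pairing are special cases of those for models of `PRA²`, applied to the `ω`-model
of all functions. -/

theorem isPRClosed_univ : IsPRClosed Set.univ := fun _ _ _ _ => trivial

instance : (omega Set.univ).IsPRA := ⟨isPRClosed_univ.models_PRA2⟩

theorem sym_omega {K : Set (ℕ → ℕ)} {n : ℕ} (P : Scheme 0 n) (x : Fin n → ℕ) :
    (omega K).sym P Fin.elim0 x = P.eval Fin.elim0 x :=
  congrArg (fun fs => P.eval fs x) (Subsingleton.elim _ _)

/-- The pairing function of the language; it is not `Nat.pair`. -/
def natPair (x y : ℕ) : ℕ := Scheme.pair.eval Fin.elim0 ![x, y]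

/-- The first projection for `natPair`. -/
def natFst (z : ℕ) : ℕ := Scheme.fst.eval Fin.elim0 ![z]

/-- The second projection for `natPair`. -/
def natSnd (z : ℕ) : ℕ := Scheme.snd.eval Fin.elim0 ![z]

/-- The code of the string with code `c` without its last `j` entries. -/
def natDrop (j c : ℕ) : ℕ := Scheme.drop.eval Fin.elim0 ![j, c]

/-- The code of the string of the first `l` values of the function `h`. -/
def natRestrict (h : ℕ → ℕ) (l : ℕ) : ℕ := Scheme.restrict.eval ![h] ![l]

theorem pair_omega {K : Set (ℕ → ℕ)} (x y : ℕ) : Model.pair (M := omega K) x y = natPair x y :=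
  sym_omega _ _

theorem fst_omega {K : Set (ℕ → ℕ)} (z : ℕ) : Model.fst (M := omega K) z = natFst z :=
  sym_omega _ _

theorem snd_omega {K : Set (ℕ → ℕ)} (z : ℕ) : Model.snd (M := omega K) z = natSnd z :=
  sym_omega _ _

theorem drop_omega {K : Set (ℕ → ℕ)} (j c : ℕ) :
    Model.drop (M := omega K) j c = natDrop j c :=
  sym_omega _ _

theorem restrict_omega {K : Set (ℕ → ℕ)} (h : (omega K).F) (l : ℕ) :
    Model.restrict (M := omega K) h l = natRestrict h.1 l := by
  refine congrArg (fun fs => Scheme.restrict.eval fs ![l]) ?_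
  funext i; fin_cases i; rfl

@[simp]
theorem natFst_natPair (x y : ℕ) : natFst (natPair x y) = x := by
  rw [← fst_omega (K := Set.univ), ← pair_omega (K := Set.univ)]
  exact Model.fst_pair (M := omega Set.univ) x y

@[simp]
theorem natSnd_natPair (x y : ℕ) : natSnd (natPair x y) = y := by
  rw [← snd_omega (K := Set.univ), ← pair_omega (K := Set.univ)]
  exact Model.snd_pair (M := omega Set.univ) x y

theorem natFst_zero : natFst 0 = 0 := natFst_natPair 0 0

theorem natPair_natFst_natSnd (z : ℕ) : natPair (natFst z) (natSnd z) = z := by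
  rw [← pair_omega (K := Set.univ), ← fst_omega (K := Set.univ), ← snd_omega (K := Set.univ)]
  exact Model.pair_fst_snd (M := omega Set.univ) z

theorem natDrop_self (c : ℕ) : natDrop c c = 0 := by
  rw [← drop_omega (K := Set.univ)]
  exact Model.drop_self (M := omega Set.univ) c

theorem natDrop_zero (c : ℕ) : natDrop 0 c = c := rfl

theorem natDrop_add_one (j c : ℕ) : natDrop (j + 1) c = natFst (natDrop j c - 1) := by
  have h (c : ℕ) : Model.pred (M := omega Set.univ) c = Nat.pred c := by
    refine (sym_omega _ _).trans ?_
    cases c <;> simp [Scheme.pred, Scheme.eval] <;> rfl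
  exact (drop_omega (K := Set.univ) (j + 1) c).symm.trans
    ((Model.drop_succ (M := omega Set.univ) j c).trans ((fst_omega _).trans
      (congrArg natFst ((h _).trans (congrArg Nat.pred (drop_omega j c))))))

theorem natRestrict_add_one (h : ℕ → ℕ) (l : ℕ) :
    natRestrict h (l + 1) = natPair (natRestrict h l) (h l) + 1 := rfl

/-- The code of a string: `0` codes the empty string, and the entries are appended in order. -/
def strCode (l : List ℕ) : ℕ := l.foldl (fun c a => natPair c a + 1) 0

theorem primrec_strCode : Primrec strCode :=
  Primrec.list_foldl .id (.const 0) (Primrec.succ.comp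
    ((Scheme.primrec₂_eval _ _).comp (Primrec.fst.comp .snd) (Primrec.snd.comp .snd))).to₂

@[simp]
theorem strCode_concat (l : List ℕ) (a : ℕ) :
    strCode (l ++ [a]) = natPair (strCode l) a + 1 := by
  simp [strCode]

/-- Every number is the code of a string, by induction on the number of entries that have to be
removed in order to reach the empty string. -/
theorem strCode_surjective : Function.Surjective strCode := by
  suffices ∀ j c, natDrop j c = 0 → ∃ l, strCode l = c from fun c => this c c (natDrop_self c)
  intro j
  induction j with
  | zero => exact fun c hc => ⟨[], hc.symm⟩
  | succ j ih =>
    intro c hc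
    have h (j : ℕ) : natDrop (j + 1) c = natDrop j (natFst (c - 1)) := by
      induction j with
      | zero => rw [natDrop_add_one]; rfl
      | succ j ih => rw [natDrop_add_one, ih, natDrop_add_one]
    obtain ⟨l, hl⟩ := ih (natFst (c - 1)) (h j ▸ hc)
    rcases c with _ | c
    · exact ⟨[], rfl⟩
    · exact ⟨l ++ [natSnd c], by simp [hl, natPair_natFst_natSnd]⟩

theorem strCode_injective : Function.Injective strCode := by
  intro l l' h
  induction l using List.reverseRecOn generalizing l' with
  | nil =>
    rcases List.eq_nil_or_concat' l' with rfl | ⟨l', b, rfl⟩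
    · rfl
    · rw [strCode_concat] at h; exact absurd h.symm (Nat.succ_ne_zero _)
  | append_singleton l a ih =>
    rcases List.eq_nil_or_concat' l' with rfl | ⟨l', b, rfl⟩
    · rw [strCode_concat] at h; exact absurd h (Nat.succ_ne_zero _)
    · rw [strCode_concat, strCode_concat, Nat.add_right_cancel_iff] at h
      have h1 := congrArg natFst h
      have h2 := congrArg natSnd h
      simp only [natFst_natPair, natSnd_natPair] at h1 h2
      rw [ih h1, h2]

theorem natFst_strCode_sub_one (l : List ℕ) : natFst (strCode l - 1) = strCode l.dropLast := by
  induction l using List.reverseRecOn with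
  | nil => exact natFst_zero
  | append_singleton l a => simp

theorem natDrop_strCode (j : ℕ) (l : List ℕ) :
    natDrop j (strCode l) = strCode (l.take (l.length - j)) := by
  induction j with
  | zero => simp [natDrop_zero]
  | succ j ih =>
    rw [natDrop_add_one, ih, natFst_strCode_sub_one, List.dropLast_eq_take, List.take_take]
    congr 2
    simp
    omega

theorem natRestrict_eq_strCode (h : ℕ → ℕ) (l : ℕ) :
    natRestrict h l = strCode ((List.range l).map h) := by
  induction l with
  | zero => rfl
  | succ l ih => rw [natRestrict_add_one, ih, List.range_succ]; simp

/-! ### The Baire category theorem in `ω`-models -/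

theorem omega_realizes_BCT {K : Set (ℕ → ℕ)} : (omega K).Realizes BCT ↔ ∀ V ∈ K,
    (∀ n σ, ∃ τ k, (∃ j, natDrop j τ = σ) ∧ ∃ j, natDrop j τ = V (natPair n k)) →
      ∃ h ∈ K, ∀ n, ∃ k l, natRestrict h l = V (natPair n k) := by
  refine Model.realizes_BCT.trans ⟨fun H V hV hd => ?_, fun H V hd => ?_⟩
  · obtain ⟨h, hh⟩ := H ⟨V, hV⟩ fun n σ => by
      obtain ⟨τ, k, ⟨i, hi⟩, j, hj⟩ := hd n σ
      exact ⟨τ, k, ⟨i, (drop_omega i τ).trans hi⟩, j,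
        (drop_omega j τ).trans (hj.trans (congrArg V (pair_omega n k).symm))⟩
    refine ⟨h.1, h.2, fun n => ?_⟩
    obtain ⟨k, l, hl⟩ := hh n
    exact ⟨k, l, (restrict_omega h l).symm.trans (hl.trans (congrArg V (pair_omega n k)))⟩
  · obtain ⟨h, hK, hh⟩ := H V.1 V.2 fun n σ => by
      obtain ⟨τ, k, ⟨i, hi⟩, j, hj⟩ := hd n σ
      exact ⟨τ, k, ⟨i, (drop_omega i τ).symm.trans hi⟩, j,
        (drop_omega j τ).symm.trans (hj.trans (congrArg V.1 (pair_omega n k)))⟩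
    refine ⟨⟨h, hK⟩, fun n => ?_⟩
    obtain ⟨k, l, hl⟩ := hh n
    exact ⟨k, l, (restrict_omega ⟨h, hK⟩ l).trans
      (hl.trans (congrArg V.1 (pair_omega n k).symm))⟩

theorem exists_natRestrict_eq_iff_mem_openSet {V : ℕ → ℕ} {n : ℕ} {S : ℕ → List ℕ}
    (hS : ∀ k, V (natPair n k) = strCode (S k)) (h : ℕ → ℕ) :
    (∃ k l, natRestrict h l = V (natPair n k)) ↔ h ∈ openSet S := by
  rw [openSet, Set.mem_iUnion]
  refine exists_congr fun k => ?_
  simp only [hS, mem_basicOpen, natRestrict_eq_strCode, strCode_injective.eq_iff]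
  exact ⟨fun ⟨l, hl⟩ => by rw [← hl]; simp, fun hh => ⟨_, hh⟩⟩

/-- Density in the sense of the formula `BCT` is topological density. -/
theorem dense_iff_dense_openSet {V : ℕ → ℕ} {S : ℕ → ℕ → List ℕ}
    (hS : ∀ n k, V (natPair n k) = strCode (S n k)) :
    (∀ n σ, ∃ τ k, (∃ j, natDrop j τ = σ) ∧ ∃ j, natDrop j τ = V (natPair n k)) ↔
      ∀ n, Dense (openSet (S n)) := by
  refine forall_congr' fun n => ?_
  rw [dense_iff_cylinder]
  constructor
  · intro H h l
    obtain ⟨τ, k, ⟨i, hi⟩, j, hj⟩ := H (strCode ((List.range l).map h))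
    obtain ⟨t, rfl⟩ := strCode_surjective τ
    rw [natDrop_strCode] at hi hj
    replace hi := strCode_injective hi
    replace hj := strCode_injective (hj.trans (hS n k))
    have key (a : ℕ) : (fun i => t.getD i 0) ∈ basicOpen (t.take a) := by
      rw [mem_basicOpen_iff]
      intro i hi
      simp only [List.length_take, lt_inf_iff] at hi
      simp [hi.2]
    refine ⟨fun i => t.getD i 0, ?_, Set.mem_iUnion.2 ⟨k, hj ▸ key _⟩⟩
    rw [← basicOpen_map_range, ← hi]
    exact key _
  · intro H σ
    obtain ⟨l, rfl⟩ := strCode_surjective σ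
    obtain ⟨g, hg, hg'⟩ := H (fun i => l.getD i 0) l.length
    obtain ⟨k, hk⟩ := Set.mem_iUnion.1 hg'
    have hl : g ∈ basicOpen l := by
      rw [mem_basicOpen_iff]
      intro i hi
      rw [PiNat.mem_cylinder_iff.1 hg i hi, List.getD_eq_getElem _ _ hi]
    have key {a b : ℕ} (hab : a ≤ b) {l : List ℕ} (hl : (List.range a).map g = l) :
        natDrop (b - a) (strCode ((List.range b).map g)) = strCode l := by
      rw [natDrop_strCode, ← hl, ← List.map_take, List.take_range]
      simp [Nat.sub_sub_self hab, min_eq_left hab]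
    exact ⟨strCode ((List.range (max l.length (S n k).length)).map g), k,
      ⟨_, key (le_max_left _ _) (mem_basicOpen.1 hl)⟩,
      _, (key (le_max_right _ _) (mem_basicOpen.1 hk)).trans (hS n k).symm⟩

theorem not_realizes_BCT_omega_setOf_primrec : ¬ (omega {f | Primrec f}).Realizes BCT := by
  classical
  obtain ⟨R, ⟨_, hR⟩, hR', hRack⟩ := exists_primrecRel_ack_le
  rw [omega_realizes_BCT]
  push Not
  have hS (n k : ℕ) : strCode (diagSeq R (natFst (natPair n k)) (natSnd (natPair n k))) =
      strCode (diagSeq R n k) := by simp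
  refine ⟨fun z => strCode (diagSeq R (natFst z) (natSnd z)), ?_,
    (dense_iff_dense_openSet (V := fun z => strCode (diagSeq R (natFst z) (natSnd z))) hS).2
      (dense_openSet_diagSeq hR'), fun h hh => ?_⟩
  · exact primrec_strCode.comp ((primrec₂_diagSeq ⟨_, hR⟩).comp
      (Scheme.primrec_eval _ _) (Scheme.primrec_eval _ _))
  · by_contra! H
    exact not_primrec_of_mem_openSet_diagSeq hR' hRack
      (fun n => (exists_natRestrict_eq_iff_mem_openSet
        (V := fun z => strCode (diagSeq R (natFst z) (natSnd z))) (hS n) h).1 (H n)) hh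

theorem isPRClosed_setOf_primrec : IsPRClosed {f | Primrec f} := by
  convert isPRClosed_primrecIn (Fin.elim0 : Fin 0 → ℕ → ℕ)
  ext f
  exact ⟨mem_primrecIn_of_primrec _, primrec_of_mem_primrecIn⟩

/-! ### Generic functions -/

namespace Scheme

/-- An injective numbering of schemes. -/
def code {k : ℕ} : {n : ℕ} → Scheme k n → ℕ
  | _, zero => Encodable.encode [0]
  | _, succ => Encodable.encode [1]
  | _, proj i => Encodable.encode [2, i.1]
  | _, oracle i => Encodable.encode [3, i.1]
  | _, @comp _ m _ P Q => Encodable.encode (4 :: m :: P.code :: List.ofFn fun j => (Q j).code)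
  | _, prec P Q => Encodable.encode [5, P.code, Q.code]

theorem code_injective {k n : ℕ} : Function.Injective (code (k := k) (n := n)) := by
  intro P P' h
  induction P with
  | zero => cases P' <;> simp [code] at h ⊢
  | succ => cases P' <;> simp [code] at h ⊢
  | proj i => cases P' <;> simp [code] at h ⊢; exact Fin.ext h
  | oracle i => cases P' <;> simp [code] at h ⊢; exact Fin.ext h
  | comp P Q ihP ihQ =>
    cases P' <;> simp only [code, Encodable.encode_inj, List.cons.injEq, reduceCtorEq, and_false,
      false_and, Nat.reduceEqDiff, OfNat.ofNat_ne_zero, OfNat.ofNat_ne_one, true_and] at h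
    obtain ⟨rfl, hP, hQ⟩ := h
    obtain rfl := ihP hP
    congr 1
    funext j
    exact ihQ j (congrFun (List.ofFn_injective hQ) j)
  | prec P Q ihP ihQ =>
    cases P' <;> simp [code] at h ⊢
    exact ⟨ihP h.1, ihQ h.2⟩

instance {k n : ℕ} : Countable (Scheme k n) := code_injective.countable

/-- Functionals given by schemes are continuous: a computation uses only finitely many values of
the function arguments. -/
theorem continuous_eval {k n : ℕ} (P : Scheme k n) :
    Continuous fun q : (Fin k → ℕ → ℕ) × (Fin n → ℕ) => P.eval q.1 q.2 := by
  induction P with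
  | zero => exact continuous_const
  | succ => exact continuous_of_discreteTopology.comp ((continuous_apply 0).comp continuous_snd)
  | proj i => exact (continuous_apply i).comp continuous_snd
  | oracle i =>
    have : Continuous fun q : (ℕ → ℕ) × ℕ => q.1 q.2 :=
      continuous_prod_of_discrete_right.2 fun y => continuous_apply y
    have hi : Continuous fun q : (Fin k → ℕ → ℕ) × (Fin 1 → ℕ) => (q.1 i, q.2 0) :=
      ((continuous_apply i).comp continuous_fst).prodMk ((continuous_apply 0).comp continuous_snd)
    exact this.comp hi
  | comp P Q ihP ihQ => exact ihP.comp (continuous_fst.prodMk (continuous_pi ihQ))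
  | @prec n P Q ihP ihQ =>
    have : Continuous fun q : ((Fin k → ℕ → ℕ) × (Fin (n + 1) → ℕ)) × ℕ =>
        (Nat.rec (P.eval q.1.1 (Fin.tail q.1.2))
          (fun y r => Q.eval q.1.1 (Fin.cons y (Fin.cons r (Fin.tail q.1.2)))) q.2 : ℕ) := by
      have ht : Continuous fun q : (Fin k → ℕ → ℕ) × (Fin (n + 1) → ℕ) => Fin.tail q.2 :=
        continuous_pi fun i => (continuous_apply i.succ).comp continuous_snd
      refine continuous_prod_of_discrete_right.2 fun y => ?_
      induction y with
      | zero => exact ihP.comp (continuous_fst.prodMk ht)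
      | succ y ih =>
        refine ihQ.comp (continuous_fst.prodMk (continuous_pi fun i => ?_))
        refine Fin.cases continuous_const (fun i => Fin.cases ih (fun i => ?_) i) i
        exact (continuous_apply i).comp ht
    exact this.comp (continuous_id.prodMk ((continuous_apply 0).comp continuous_snd))

end Scheme

/-- The string with a given code. -/
noncomputable def strDecode : ℕ → List ℕ := Function.surjInv strCode_surjective

theorem strCode_strDecode (c : ℕ) : strCode (strDecode c) = c :=
  Function.surjInv_eq strCode_surjective c

/-- The `n`-th open set that is coded by `V`. -/
def codedOpenSet (V : ℕ → ℕ) (n : ℕ) : Set (ℕ → ℕ) :=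
  openSet fun k => strDecode (V (natPair n k))

theorem primrec_getD (l : List ℕ) : Primrec fun i => l.getD i 0 :=
  (Primrec.list_getD 0).comp (.const l) .id

open Filter

/-- If no function that is primitive recursive in `hs` dominates `f`, then the functions `h` for
which a given functional of `hs` and `h` drops below `f` beyond `N` are dense, because the
eventually vanishing functions are dense and primitive recursive. -/
theorem dense_setOf_exists_eval_lt {s : ℕ} {hs : Fin s → ℕ → ℕ} {f : ℕ → ℕ}
    (hf : ∀ g ∈ primrecIn hs, ¬ ∀ᶠ n in atTop, f n ≤ g n) (P : Scheme (s + 1) 1) (N : ℕ) :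
    Dense {h : ℕ → ℕ | ∃ n ≥ N, P.eval (Fin.snoc hs h : Fin (s + 1) → ℕ → ℕ) ![n] < f n} := by
  refine dense_iff_cylinder.2 fun g l => ?_
  refine ⟨fun i => ((List.range l).map g).getD i 0, ?_, ?_⟩
  · exact PiNat.mem_cylinder_iff.2 fun i hi => by simp [hi]
  · have := hf _ (isPRClosed_primrecIn hs _ P
      (Fin.snoc hs (fun i => ((List.range l).map g).getD i 0) : Fin (s + 1) → ℕ → ℕ) fun i => by
        refine Fin.lastCases ?_ (fun i => ?_) i
        · rw [Fin.snoc_last]; exact mem_primrecIn_of_primrec hs (primrec_getD _)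
        · rw [Fin.snoc_castSucc]; exact mem_primrecIn hs i)
    rw [eventually_atTop] at this
    push Not at this
    exact this N

theorem isOpen_setOf_exists_eval_lt {s : ℕ} (hs : Fin s → ℕ → ℕ) (f : ℕ → ℕ)
    (P : Scheme (s + 1) 1) (N : ℕ) :
    IsOpen {h : ℕ → ℕ | ∃ n ≥ N, P.eval (Fin.snoc hs h : Fin (s + 1) → ℕ → ℕ) ![n] < f n} := by
  have hc (n : ℕ) : Continuous fun h : ℕ → ℕ =>
      P.eval (Fin.snoc hs h : Fin (s + 1) → ℕ → ℕ) ![n] := by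
    refine P.continuous_eval.comp (.prodMk (continuous_pi fun i => ?_) continuous_const)
    induction i using Fin.lastCases with
    | last => exact continuous_id.congr fun h => (Fin.snoc_last (α := fun _ => ℕ → ℕ) h hs).symm
    | cast i =>
      exact (continuous_const (y := hs i)).congr fun h =>
        (Fin.snoc_castSucc (α := fun _ => ℕ → ℕ) h hs i).symm
  simp only [Set.ofPred_exists, Set.ofPred_and]
  exact isOpen_iUnion fun n =>
    isOpen_const.inter ((isOpen_discrete (Set.Iio (f n))).preimage (hc n))

/-- A sufficiently generic function is in all the dense open sets that are coded by functions
primitive recursive in `hs`, and adding it to `hs` does not create functions that dominate `f`. -/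
theorem exists_generic {s : ℕ} {hs : Fin s → ℕ → ℕ} {f : ℕ → ℕ}
    (hf : ∀ g ∈ primrecIn hs, ¬ ∀ᶠ n in atTop, f n ≤ g n) :
    ∃ h : ℕ → ℕ,
      (∀ g ∈ primrecIn (Fin.snoc hs h : Fin (s + 1) → ℕ → ℕ), ¬ ∀ᶠ n in atTop, f n ≤ g n) ∧
      ∀ V ∈ primrecIn hs, ∀ n, Dense (codedOpenSet V n) → h ∈ codedOpenSet V n := by
  let U (i : {q : Scheme s 1 × ℕ // Dense (codedOpenSet (fun y => q.1.eval hs ![y]) q.2)}) :=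
    codedOpenSet (fun y => i.1.1.eval hs ![y]) i.1.2
  let W (q : Scheme (s + 1) 1 × ℕ) :=
    {h : ℕ → ℕ | ∃ n ≥ q.2, q.1.eval (Fin.snoc hs h : Fin (s + 1) → ℕ → ℕ) ![n] < f n}
  obtain ⟨h, hh⟩ := (dense_iInter_of_isOpen (f := Sum.elim U W)
    (Sum.rec (fun i => isOpen_openSet _) fun q => isOpen_setOf_exists_eval_lt hs f q.1 q.2)
    (Sum.rec (fun i => i.2) fun q => dense_setOf_exists_eval_lt hf q.1 q.2)).nonempty
  rw [Set.mem_iInter] at hh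
  refine ⟨h, ?_, ?_⟩
  · rintro _ ⟨P, rfl⟩ H
    obtain ⟨N, hN⟩ := eventually_atTop.1 H
    obtain ⟨n, hn, hlt⟩ := hh (.inr (P, N))
    exact hlt.not_ge (hN n hn)
  · rintro _ ⟨P, rfl⟩ n hd
    exact hh (.inl ⟨(P, n), hd⟩)

/-- Adding generic functions one after the other leads to an `ω`-model of `PRA² + BCT`. -/
theorem exists_omega_models_BCT {f : ℕ → ℕ}
    (hf : ∀ g, Primrec g → ¬ ∀ᶠ n in atTop, f n ≤ g n) :
    ∃ K : Set (ℕ → ℕ), IsPRClosed K ∧ (omega K).Realizes BCT ∧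
      ∀ g ∈ K, ¬ ∀ᶠ n in atTop, f n ≤ g n := by
  have hstep (s : ℕ) (hs : Fin s → ℕ → ℕ) : ∃ h : ℕ → ℕ,
      (∀ g ∈ primrecIn hs, ¬ ∀ᶠ n in atTop, f n ≤ g n) →
        (∀ g ∈ primrecIn (Fin.snoc hs h : Fin (s + 1) → ℕ → ℕ), ¬ ∀ᶠ n in atTop, f n ≤ g n) ∧
        ∀ V ∈ primrecIn hs, ∀ n, Dense (codedOpenSet V n) → h ∈ codedOpenSet V n := by
    by_cases hs' : ∀ g ∈ primrecIn hs, ¬ ∀ᶠ n in atTop, f n ≤ g n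
    · obtain ⟨h, hh⟩ := exists_generic hs'
      exact ⟨h, fun _ => hh⟩
    · exact ⟨0, fun h => absurd h hs'⟩
  choose nxt hnxt using hstep
  obtain ⟨h, hh⟩ : ∃ h : ℕ → ℕ → ℕ, ∀ s, h s = nxt s fun i => h i :=
    ⟨Nat.lt_wfRel.wf.fix fun s ih => nxt s fun i => ih i i.2, fun s => WellFounded.fix_eq _ _ _⟩
  have hgood (s : ℕ) : ∀ g ∈ primrecIn (fun i : Fin s => h i), ¬ ∀ᶠ n in atTop, f n ≤ g n := by
    induction s with
    | zero => exact fun g hg => hf g (primrec_of_mem_primrecIn hg)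
    | succ s ih =>
      have e : (fun i : Fin (s + 1) => h i) =
          (Fin.snoc (fun i : Fin s => h i) (h s) : Fin (s + 1) → ℕ → ℕ) := by
        funext i
        refine Fin.lastCases ?_ (fun i => ?_) i
        · rw [Fin.snoc_last]; rfl
        · rw [Fin.snoc_castSucc]; rfl
      rw [e, hh s]
      exact (hnxt s _ ih).1
  refine ⟨⋃ s, primrecIn fun i : Fin s => h i, isPRClosed_iUnion_primrecIn h,
    omega_realizes_BCT.2 fun V hV hd => ?_, fun g hg => ?_⟩
  · obtain ⟨s, hs⟩ := Set.mem_iUnion.1 hV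
    have hS (n k : ℕ) : V (natPair n k) = strCode (strDecode (V (natPair n k))) :=
      (strCode_strDecode _).symm
    refine ⟨h s, Set.mem_iUnion.2 ⟨s + 1, mem_primrecIn (fun i : Fin (s + 1) => h i) (Fin.last s)⟩,
      fun n => (exists_natRestrict_eq_iff_mem_openSet (hS n) (h s)).2 ?_⟩
    rw [hh s]
    exact (hnxt s _ (hgood s)).2 V hs n ((dense_iff_dense_openSet hS).1 hd n)
  · obtain ⟨s, hs⟩ := Set.mem_iUnion.1 hg
    exact hgood s g hs

theorem not_eventually_ack_self_le {g : ℕ → ℕ} (hg : Primrec g) :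
    ¬ ∀ᶠ n in atTop, ack n n ≤ g n := by
  intro h
  obtain ⟨N, hN⟩ := exists_forall_lt_ack_self hg
  obtain ⟨n, hn, hn'⟩ := (h.and (eventually_ge_atTop N)).exists
  exact (hN n hn').not_ge hn

/-- An instance of `QF-AC` gives a function that dominates the diagonal of the Ackermann
function. -/
theorem exists_QFAC_not_realizes_omega :
    ∃ φ ∈ QFAC, ∀ K : Set (ℕ → ℕ), (∀ g ∈ K, ¬ ∀ᶠ n in atTop, ack n n ≤ g n) →
      ¬ (omega K).Realizes φ := by
  classical
  obtain ⟨R, hR, hR', hRack⟩ := exists_primrecRel_ack_le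
  obtain ⟨P, hP⟩ := Scheme.exists_of_primrec₂ 0 (f := fun j m => if R j m then 0 else 1)
    (Primrec.ite hR (.const 0) (.const 1))
  let θ : Fml 0 2 := .eq (.sym P ![] ![.var 1, .var 0]) .zero
  have hθ {K : Set (ℕ → ℕ)} (e : Fin 0 → (omega K).F) (v : Fin 2 → (omega K).N) :
      (omega K).Sat e v θ ↔ R (v 1) (v 0) := by
    have h : (omega K).val e v (.sym P ![] ![.var 1, .var 0]) =
        if R (v 1) (v 0) then (0 : ℕ) else 1 :=
      (Model.val_sym_two _ _ _ _ _).trans ((sym_omega _ _).trans (hP _ _ _))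
    refine (Eq.congr_left h).trans ?_
    change (if R (v 1) (v 0) then (0 : ℕ) else 1) = 0 ↔ _
    simp
  refine ⟨_, .choice 0 0 θ trivial, fun K hK H => ?_⟩
  have := (Model.realizes_close _).1 H Fin.elim0 Fin.elim0
  simp only [Model.Sat, Model.sat_subst_of_isQF _ _ _ _ θ trivial] at this
  obtain ⟨g, hg⟩ := this fun x => let ⟨m, hm⟩ := hR' x; ⟨m, (hθ _ _).2 hm⟩
  exact hK g.1 g.2 (.of_forall fun n => hRack _ _ ((hθ _ _).1 (hg n)))

end SecondOrderPRA

open SecondOrderPRA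
theorem mainTheorem2 :
    -- `PRA² + BCT` lies strictly between `PRA²` and `RCA₀`
    Theory.StrictlyBelow PRA2 (PRA2 ∪ {BCT}) ∧
    Theory.StrictlyBelow (PRA2 ∪ {BCT}) RCA0 ∧
    -- a uniformly primitive recursive sequence of dense open sets without primitive recursive
    -- points in the intersection
    (∃ V : ℕ → ℕ → List ℕ, Primrec₂ V ∧ (∀ n, Dense (openSet (V n))) ∧
      ∀ h : ℕ → ℕ, h ∈ ⋂ n, openSet (V n) → ¬ Primrec h) ∧
    -- an `ω`-model of `PRA² + BCT` in which no function dominates a fixed computable function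
    (∃ f : ℕ → ℕ, Computable f ∧ ∃ K : Set (ℕ → ℕ), (omega K).Models (PRA2 ∪ {BCT}) ∧
      ∀ g ∈ K, ¬ ∀ᶠ n in Filter.atTop, f n ≤ g n) := by
  classical
  obtain ⟨K, hK, hBCT, hdom⟩ := exists_omega_models_BCT (f := fun n => ack n n)
    fun _ => not_eventually_ack_self_le
  have hK' : (omega K).Models (PRA2 ∪ {BCT}) := by
    rintro φ (hφ | rfl)
    exacts [hK.models_PRA2 φ hφ, hBCT]
  refine ⟨⟨fun φ hφ M hM => hφ M fun ψ hψ => hM ψ (.inl hψ), BCT, fun M hM => hM _ (.inr rfl),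
    fun h => ?_⟩, ⟨fun φ hφ M hM => hφ M ?_, ?_⟩, ?_,
    fun n => ack n n, computable₂_ack.comp .id .id, K, hK', hdom⟩
  · exact not_realizes_BCT_omega_setOf_primrec (h _ isPRClosed_setOf_primrec.models_PRA2)
  · have : M.IsPRA := ⟨fun ψ hψ => hM ψ (.inl hψ)⟩
    rintro ψ (hψ | rfl)
    exacts [hM ψ (.inl hψ), Model.realizes_BCT_of_models_RCA0 hM]
  · obtain ⟨φ, hφ, hφ'⟩ := exists_QFAC_not_realizes_omega
    exact ⟨φ, fun M hM => hM φ (.inr hφ), fun h => hφ' K hdom (h _ hK')⟩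
  · obtain ⟨R, hR, hR', hRack⟩ := exists_primrecRel_ack_le
    exact ⟨diagSeq R, primrec₂_diagSeq hR, dense_openSet_diagSeq hR', fun h hh =>
      not_primrec_of_mem_openSet_diagSeq hR' hRack (Set.mem_iInter.1 hh)⟩
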